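/- Let $a:\mathbb R^d\to\mathbb R$ satisfy $a\ge 0$, $\int_{\mathbb R^d}a(z)\,dz=1$, $\int_{\mathbb R^d}|z|^2a(z)\,dz<\infty$, and let $\alpha_1>0$ and $\alpha_2$ be real constants. Then there exist positive constants $C_4$ and $\gamma_0$, depending only on $d,a,\alpha_1,\alpha_2$ (in particular deterministic, and independent of $N$, $s$ and $u_0$ below), such that the following holds. Let $(\Omega,\mathcal F,P)$ be a probability space and let $\mu_\omega(x,y;t)$, $\omega\in\Omega$, $x,y\in\mathbb T^d=\mathbb R^d/\mathbb Z^d$, $t\in\mathbb R$, be a measurable random coefficient with $\alpha_1\le\mu_\omega(x,y;t)\le\alpha_2$ that is stationary and ergodic in time: $\mu_\omega(x,y;t+s)=\mu_{\tau_s\omega}(x,y;t)$ for a measure preserving ergodic dynamical system $(\tau_s)_{s\in\mathbb R}$ on $\Omega$. Let $A_\omega(t)$ be the bounded operator on the real space $L^2(\mathbb T^d)$ $$A_\omega(t)v(\xi)=\int_{\mathbb R^d}\big(v(\xi-z)-v(\xi)\big)\,a(z)\,\mu_\omega(\xi,\xi-z;t)\,dz,$$ and $A_\omega^*(t)$ its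 adjoint. Let $\omega\in\Omega$, $N>0$, $u_0\in L^2(\mathbb T^d)$, and let $u$ and $p^N$ be solutions in $L^2(\mathbb T^d)$ (continuous in time, and satisfying the equations integrated in time) of $$\partial_t u=A_\omega(t)u,\quad t\ge 0,\qquad u|_{t=0}=u_0;\qquad\qquad -\partial_t p^N=A^*_\omega(t)p^N,\quad t\le N,\qquad p^N|_{t=N}=1.$$ Put $C(N)=\int_{\mathbb T^d}u_0(\xi)\,p^N(\xi,0)\,d\xi$. Then for all $s\in(0,N]$ $$\|u(\cdot,s)-C(N)\|_{L^2(\mathbb T^d)}\le C_4\,e^{-\gamma_0 s}\,\|u_0\|_{L^2(\mathbb T^d)}.$$ -/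

import Mathlib

open MeasureTheory Set

noncomputable section

/-- The quotient map `ℝ^d → 𝕋^d = ℝ^d / ℤ^d`. -/
def torusProj {d : ℕ} (z : EuclideanSpace ℝ (Fin d)) : UnitAddTorus (Fin d) :=
  fun i => ((z i : ℝ) : UnitAddCircle)

/-- The real space `L²(𝕋^d)`; the volume of `𝕋^d` is the product Lebesgue measure, of total
mass one. -/
abbrev TorusL2 (d : ℕ) : Type :=
  Lp ℝ 2 (volume : Measure (UnitAddTorus (Fin d)))

/-- The conditions on the convolution kernel: `a` is integrable, `a ≥ 0`, `∫ a = 1`, and `a` has a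
finite second moment. -/
structure IsJumpKernel {d : ℕ} (a : EuclideanSpace ℝ (Fin d) → ℝ) : Prop where
  integrable : Integrable a
  nonneg : ∀ z, 0 ≤ a z
  integral_eq_one : ∫ z, a z = 1
  second_moment : Integrable (fun z => ‖z‖ ^ 2 * a z)

/-- A measure preserving and ergodic dynamical system `τ_s : Ω → Ω`, `s ∈ ℝ`. -/
structure IsErgodicFlow {Ω : Type*} [MeasurableSpace Ω] (P : Measure Ω) (τ : ℝ → Ω → Ω) :
    Prop where
  map_zero : ∀ ω, τ 0 ω = ω
  map_add : ∀ s t ω, τ (s + t) ω = τ s (τ t ω)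
  measurePreserving : ∀ s, MeasurePreserving (τ s) P P
  ergodic : ∀ B : Set Ω, MeasurableSet B → (∀ s, τ s ⁻¹' B = B) → P B = 0 ∨ P B = 1

/-- `μ ω x y t` is a random coefficient, periodic in `x` and `y` (that is, `x, y ∈ 𝕋^d`),
measurable, pinched between `α₁` and `α₂`, stationary and ergodic in the time variable `t`. -/
structure IsRandomCoefficient {d : ℕ} {Ω : Type*} [MeasurableSpace Ω] (P : Measure Ω)
    (α₁ α₂ : ℝ) (μ : Ω → UnitAddTorus (Fin d) → UnitAddTorus (Fin d) → ℝ → ℝ) : Prop where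
  measurable : Measurable
    (fun q : Ω × UnitAddTorus (Fin d) × UnitAddTorus (Fin d) × ℝ => μ q.1 q.2.1 q.2.2.1 q.2.2.2)
  lower : ∀ ω x y t, α₁ ≤ μ ω x y t
  upper : ∀ ω x y t, μ ω x y t ≤ α₂
  stationary_ergodic : ∃ τ : ℝ → Ω → Ω, IsErgodicFlow P τ ∧
    ∀ ω x y t s, μ ω x y (t + s) = μ (τ s ω) x y t

/-- The pointwise expression
`(A v)(ξ) = ∫_{ℝ^d} (v(ξ - z) - v(ξ)) a(z) m(ξ, ξ - z) dz`, `ξ ∈ 𝕋^d`. -/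
def nonlocalIntegral {d : ℕ} (a : EuclideanSpace ℝ (Fin d) → ℝ)
    (m : UnitAddTorus (Fin d) → UnitAddTorus (Fin d) → ℝ)
    (v : UnitAddTorus (Fin d) → ℝ) (ξ : UnitAddTorus (Fin d)) : ℝ :=
  ∫ z : EuclideanSpace ℝ (Fin d), (v (ξ - torusProj z) - v ξ) * a z * m ξ (ξ - torusProj z)

/-- The bounded operator `B` on `L²(𝕋^d)` acts by the pointwise expression `nonlocalIntegral`. -/
def IsNonlocalOperator {d : ℕ} (a : EuclideanSpace ℝ (Fin d) → ℝ)
    (m : UnitAddTorus (Fin d) → UnitAddTorus (Fin d) → ℝ)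
    (B : TorusL2 d →L[ℝ] TorusL2 d) : Prop :=
  ∀ v : TorusL2 d, ⇑(B v) =ᵐ[volume] nonlocalIntegral a m v

open Classical in
/-- The bounded operator on `L²(𝕋^d)` given by `nonlocalIntegral`. It exists for every kernel `a`
and every bounded measurable `m`, see `isNonlocalOperator_nonlocalOperator`; the default value `0`
is used only for other data. -/
def nonlocalOperator {d : ℕ} (a : EuclideanSpace ℝ (Fin d) → ℝ)
    (m : UnitAddTorus (Fin d) → UnitAddTorus (Fin d) → ℝ) : TorusL2 d →L[ℝ] TorusL2 d :=
  if h : ∃ B : TorusL2 d →L[ℝ] TorusL2 d, IsNonlocalOperator a m B then h.choose else 0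

/-- `u` solves `∂_t u = A(t) u` for `t ≥ 0`, `u(0) = u₀`, in `L²(𝕋^d)`. As the coefficients are only
measurable in time, the equation is understood in the usual (Carathéodory) sense: `u` is continuous
and equals the integral of its right-hand side. -/
def IsForwardSolution {d : ℕ} (A : ℝ → TorusL2 d →L[ℝ] TorusL2 d) (u₀ : TorusL2 d)
    (u : ℝ → TorusL2 d) : Prop :=
  ContinuousOn u (Ici 0) ∧
    ∀ t, 0 ≤ t → IntervalIntegrable (fun s => A s (u s)) volume 0 t ∧
      u t = u₀ + ∫ s in (0 : ℝ)..t, A s (u s)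

/-- `p` solves `-∂_t p = A*(t) p` for `t ≤ N`, `p(N) = 1`, in `L²(𝕋^d)`, in the same sense; here
`A*(t)` is the adjoint of `A(t)` in `L²(𝕋^d)`. -/
def IsBackwardSolution {d : ℕ} (A : ℝ → TorusL2 d →L[ℝ] TorusL2 d) (N : ℝ)
    (p : ℝ → TorusL2 d) : Prop :=
  ContinuousOn p (Iic N) ∧
    ∀ t, t ≤ N →
      IntervalIntegrable (fun s => ContinuousLinearMap.adjoint (A s) (p s)) volume t N ∧
      p t = Lp.const 2 volume (1 : ℝ) + ∫ s in t..N, ContinuousLinearMap.adjoint (A s) (p s)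

theorem measurable_torusProj {d : ℕ} : Measurable (torusProj (d := d)) := by
  refine measurable_pi_lambda _ fun i => ?_
  exact (AddCircle.measurable_mk' (a := (1 : ℝ))).comp (by fun_prop)

theorem measurePreserving_sub_torusProj {d : ℕ} (ν : Measure (EuclideanSpace ℝ (Fin d)))
    [IsProbabilityMeasure ν] :
    MeasurePreserving (fun q : EuclideanSpace ℝ (Fin d) × UnitAddTorus (Fin d) =>
      q.2 - torusProj q.1) (ν.prod volume) volume := by
  have h1 := (MeasurePreserving.id ν).skew_product (μc := (volume : Measure (UnitAddTorus (Fin d))))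
    (μd := (volume : Measure (UnitAddTorus (Fin d)))) (g := fun z ξ => ξ - torusProj z)
    (measurable_snd.sub (measurable_torusProj.comp measurable_fst))
    (Filter.Eventually.of_forall fun z =>
      (measurePreserving_sub_right (volume : Measure (UnitAddTorus (Fin d))) (torusProj z)).map_eq)
  exact measurePreserving_snd.comp h1

/-- Averaging in the first variable is a contraction in `L²`. -/
theorem memLp_integral_left {X Y : Type*} [MeasurableSpace X] [MeasurableSpace Y]
    (ν : Measure X) [IsProbabilityMeasure ν] (ρ : Measure Y) [SFinite ρ] {w : X × Y → ℝ}
    (hw : MemLp w 2 (ν.prod ρ)) :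
    MemLp (fun y => ∫ x, w (x, y) ∂ν) 2 ρ ∧
      eLpNorm (fun y => ∫ x, w (x, y) ∂ν) 2 ρ ≤ eLpNorm w 2 (ν.prod ρ) := by
  have hm : AEStronglyMeasurable (fun y => ∫ x, w (x, y) ∂ν) ρ :=
    hw.1.prod_swap.integral_prod_right'
  have hle : eLpNorm (fun y => ∫ x, w (x, y) ∂ν) 2 ρ ≤ eLpNorm w 2 (ν.prod ρ) := by
    rw [eLpNorm_eq_lintegral_rpow_enorm_toReal (by norm_num) (by norm_num),
      eLpNorm_eq_lintegral_rpow_enorm_toReal (by norm_num) (by norm_num)]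
    refine ENNReal.rpow_le_rpow ?_ (by norm_num)
    rw [lintegral_prod_symm _ (hw.1.enorm.pow_const _)]
    refine lintegral_mono_ae ?_
    have hs : ∀ᵐ y ∂ρ, AEStronglyMeasurable (fun x => w (x, y)) ν :=
      hw.1.prod_swap.prodMk_left
    filter_upwards [hs] with y hy
    have h1 : ‖∫ x, w (x, y) ∂ν‖ₑ ≤ eLpNorm (fun x => w (x, y)) 1 ν := by
      rw [eLpNorm_one_eq_lintegral_enorm]
      exact enorm_integral_le_lintegral_enorm _
    have h2 : eLpNorm (fun x => w (x, y)) 1 ν ≤ eLpNorm (fun x => w (x, y)) 2 ν :=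
      eLpNorm_le_eLpNorm_of_exponent_le (by norm_num) hy
    have h3 := ENNReal.rpow_le_rpow (h1.trans h2) (z := (2 : ENNReal).toReal) (by norm_num)
    refine h3.trans (le_of_eq ?_)
    rw [eLpNorm_eq_lintegral_rpow_enorm_toReal (by norm_num) (by norm_num), ← ENNReal.rpow_mul]
    norm_num
  exact ⟨⟨hm, hle.trans_lt hw.2⟩, hle⟩

theorem exists_isNonlocalOperator {d : ℕ} {a : EuclideanSpace ℝ (Fin d) → ℝ} (ha : IsJumpKernel a)
    {m : UnitAddTorus (Fin d) → UnitAddTorus (Fin d) → ℝ}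
    (hm : Measurable (fun q : UnitAddTorus (Fin d) × UnitAddTorus (Fin d) => m q.1 q.2))
    {M : ℝ} (hM : ∀ x y, |m x y| ≤ M) :
    ∃ B : TorusL2 d →L[ℝ] TorusL2 d, IsNonlocalOperator a m B := by
  set ν : Measure (EuclideanSpace ℝ (Fin d)) :=
    volume.withDensity (fun z => ENNReal.ofReal (a z)) with hν
  have hνp : IsProbabilityMeasure ν := by
    refine ⟨?_⟩
    rw [hν, withDensity_apply _ MeasurableSet.univ, Measure.restrict_univ,
      ← ofReal_integral_eq_lintegral_ofReal ha.integrable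
        (Filter.Eventually.of_forall ha.nonneg), ha.integral_eq_one, ENNReal.ofReal_one]
  let w : (UnitAddTorus (Fin d) → ℝ) → EuclideanSpace ℝ (Fin d) × UnitAddTorus (Fin d) → ℝ :=
    fun v q => m q.2 (q.2 - torusProj q.1) * (v (q.2 - torusProj q.1) - v q.2)
  have hS := measurePreserving_sub_torusProj ν
  have hT : MeasurePreserving (Prod.snd : EuclideanSpace ℝ (Fin d) × UnitAddTorus (Fin d) → _)
    (ν.prod volume) volume := measurePreserving_snd
  have hform : ∀ v ξ, nonlocalIntegral a m v ξ = ∫ z, w v (z, ξ) ∂ν := by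
    intro v ξ
    rw [hν, integral_withDensity_eq_integral_toReal_smul₀
      ha.integrable.1.aemeasurable.ennreal_ofReal (by simp)]
    refine integral_congr_ae (Filter.Eventually.of_forall fun z => ?_)
    simp only [w, ENNReal.toReal_ofReal (ha.nonneg z), smul_eq_mul]
    ring
  have hmS : AEStronglyMeasurable (fun q : EuclideanSpace ℝ (Fin d) × UnitAddTorus (Fin d) =>
      m q.2 (q.2 - torusProj q.1)) (ν.prod volume) :=
    (hm.comp (measurable_snd.prodMk hS.measurable)).aestronglyMeasurable
  have hw : ∀ v : TorusL2 d, MemLp (w v) 2 (ν.prod volume) ∧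
      eLpNorm (w v) 2 (ν.prod volume) ≤
        ENNReal.ofReal M * (eLpNorm v 2 volume + eLpNorm v 2 volume) := by
    intro v
    have h1 := (Lp.memLp v).comp_measurePreserving hS
    have h2 := (Lp.memLp v).comp_measurePreserving hT
    have h3 := h1.sub h2
    have hb : ∀ᵐ q ∂(ν.prod volume), ‖w v q‖ ≤ M * ‖(((v : UnitAddTorus (Fin d) → ℝ) ∘ fun q :
        EuclideanSpace ℝ (Fin d) × UnitAddTorus (Fin d) => q.2 - torusProj q.1) -
          (v : UnitAddTorus (Fin d) → ℝ) ∘ Prod.snd :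
            EuclideanSpace ℝ (Fin d) × UnitAddTorus (Fin d) → ℝ) q‖ := by
      refine Filter.Eventually.of_forall fun q => ?_
      simp only [w, norm_mul, Pi.sub_apply, Function.comp]
      exact mul_le_mul_of_nonneg_right (hM _ _) (norm_nonneg _)
    refine ⟨MemLp.of_le_mul h3 (hmS.mul h3.1) hb, ?_⟩
    refine (eLpNorm_le_mul_eLpNorm_of_ae_le_mul hb 2).trans ?_
    gcongr
    refine (eLpNorm_sub_le h1.1 h2.1 (by norm_num)).trans ?_
    rw [eLpNorm_comp_measurePreserving (Lp.memLp v).1 hS,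
      eLpNorm_comp_measurePreserving (Lp.memLp v).1 hT]
  have hF : ∀ v : TorusL2 d, MemLp (nonlocalIntegral a m v) 2 volume ∧
      eLpNorm (nonlocalIntegral a m v) 2 volume ≤
        ENNReal.ofReal M * (eLpNorm v 2 volume + eLpNorm v 2 volume) := by
    intro v
    have h := memLp_integral_left ν volume (hw v).1
    have he : nonlocalIntegral a m v = fun ξ => ∫ z, w v (z, ξ) ∂ν := funext (hform v)
    rw [he]
    exact ⟨h.1, h.2.trans (hw v).2⟩
  have hint : ∀ v : TorusL2 d, ∀ᵐ ξ ∂(volume : Measure (UnitAddTorus (Fin d))),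
      Integrable (fun z => w v (z, ξ)) ν := fun v =>
    ((hw v).1.integrable (by norm_num)).prod_left_ae
  have hcongr : ∀ {f g : UnitAddTorus (Fin d) → ℝ}, f =ᵐ[volume] g →
      nonlocalIntegral a m f =ᵐ[volume] nonlocalIntegral a m g := by
    intro f g hfg
    have h1 : w f =ᵐ[ν.prod volume] w g := by
      filter_upwards [hS.quasiMeasurePreserving.ae_eq_comp hfg,
        hT.quasiMeasurePreserving.ae_eq_comp hfg] with q h1 h2
      simp only [Function.comp] at h1 h2
      simp only [w, h1, h2]
    have h2 : ∀ᵐ ξ ∂(volume : Measure (UnitAddTorus (Fin d))), ∀ᵐ z ∂ν, w f (z, ξ) = w g (z, ξ) :=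
      Measure.ae_ae_of_ae_prod
        ((Measure.measurePreserving_swap (μ := volume) (ν := ν)).quasiMeasurePreserving.ae h1)
    filter_upwards [h2] with ξ hξ
    rw [hform, hform]
    exact integral_congr_ae hξ
  let L : TorusL2 d →ₗ[ℝ] TorusL2 d :=
    { toFun := fun v => (hF v).1.toLp _
      map_add' := by
        intro v v'
        rw [← MemLp.toLp_add]
        refine MemLp.toLp_congr _ _ ?_
        filter_upwards [hcongr (Lp.coeFn_add v v'), hint v, hint v'] with ξ h1 h2 h3
        rw [h1, Pi.add_apply, hform, hform, hform, ← integral_add h2 h3]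
        refine integral_congr_ae (Filter.Eventually.of_forall fun z => ?_)
        simp only [w, Pi.add_apply]
        ring
      map_smul' := by
        intro c v
        rw [RingHom.id_apply, ← MemLp.toLp_const_smul]
        refine MemLp.toLp_congr _ _ ?_
        filter_upwards [hcongr (Lp.coeFn_smul c v)] with ξ h1
        rw [h1, Pi.smul_apply, hform, hform, smul_eq_mul, ← integral_const_mul]
        refine integral_congr_ae (Filter.Eventually.of_forall fun z => ?_)
        simp only [w, Pi.smul_apply, smul_eq_mul]
        ring }
  have hM0 : 0 ≤ M := (abs_nonneg _).trans (hM 0 0)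
  refine ⟨L.mkContinuous (M * 2) fun v => ?_, fun v => (hF v).1.coeFn_toLp⟩
  change ‖(hF v).1.toLp _‖ ≤ _
  rw [Lp.norm_toLp]
  refine (ENNReal.toReal_mono (ENNReal.mul_ne_top ENNReal.ofReal_ne_top
    (ENNReal.add_ne_top.2 ⟨(Lp.memLp v).2.ne, (Lp.memLp v).2.ne⟩)) (hF v).2).trans ?_
  rw [ENNReal.toReal_mul, ENNReal.toReal_ofReal hM0,
    ENNReal.toReal_add (Lp.memLp v).2.ne (Lp.memLp v).2.ne, Lp.norm_def]
  exact le_of_eq (by ring)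

/-- For a kernel `a` and bounded measurable `m`, the operator is the intended one. -/
theorem isNonlocalOperator_nonlocalOperator {d : ℕ} {a : EuclideanSpace ℝ (Fin d) → ℝ}
    (ha : IsJumpKernel a) {m : UnitAddTorus (Fin d) → UnitAddTorus (Fin d) → ℝ}
    (hm : Measurable (fun q : UnitAddTorus (Fin d) × UnitAddTorus (Fin d) => m q.1 q.2))
    {M : ℝ} (hM : ∀ x y, |m x y| ≤ M) :
    IsNonlocalOperator a m (nonlocalOperator a m) := by
  have h := exists_isNonlocalOperator ha hm hM
  rw [nonlocalOperator, dif_pos h]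
  exact h.choose_spec

end

/-! The proof is by duality: decay is shown for the adjoint equation run backwards in time and then
transferred to `u`. The operators `A(t)` annihilate constants, so the adjoint evolution conserves
mass. It is also positive, because `A(t) + α₂` dominates `α₁` times the `transition` operator of the
jump measure, and this order relation passes to adjoints.

Doeblin's argument gives contraction in `L¹`. The jump measure is absolutely continuous on the
torus, so some convolution power of it dominates a multiple of Haar measure
(`exists_le_smul_convPow`). Hence after `n` units of time the adjoint evolution of nonnegative data
lies above a fixed fraction of its mass, spread uniformly. Positive and negative parts of mean zero
data therefore cancel in part, and the `L¹` norm shrinks by a fixed factor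
(`IsDoeblinFamily.absMass_le_of_mass_eq_zero`).

The step from `L¹` to `L²` uses dissipativity: `⟨A v, v⟩ ≤ -(α₁/2)‖v‖² + K‖v‖₁²`
(`exists_inner_nonlocal_self_le`), obtained by truncating the jump density. A combination `‖x‖² +
L‖x‖₁²` then decays geometrically (`IsDoeblinFamily.exists_decay`).

For the transfer, put `e = 1`, `w = u(s) - C(N) e`, `b = ∫ w` and `q = w - b p(s)`. Since `∫ p(s) =
1`, `q` has mean zero. Since `⟨u(s), p(s)⟩ = ⟨u₀, p(0)⟩ = C(N)`, one gets `⟨u(s), q⟩ = ‖w‖²`. By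
`IsLinearEvolution.inner_duality` this equals `⟨u₀, Q(s)⟩`, where `Q` is the adjoint evolution
started from `q`, and `Q` decays exponentially.

As the coefficients are only measurable in time, derivatives are avoided: increments are compared
with those of the frozen state up to an error quadratic in the time step, which is enough for
Grönwall's inequality. -/

/-! ### Linear evolution equations with bounded measurable coefficients -/

section Evolution

open Filter Topology

/-- A Grönwall inequality under an upper bound of the increments up to a quadratic error. -/
theorem le_gronwallBound_of_quadratic_error {f : ℝ → ℝ} {K ε C T : ℝ}
    (hf : ContinuousOn f (Icc 0 T))
    (h : ∀ s t, 0 ≤ s → s ≤ t → t ≤ T → f t ≤ f s + (K * f s + ε) * (t - s) + C * (t - s) ^ 2) :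
    ∀ t ∈ Icc 0 T, f t ≤ gronwallBound (f 0) K ε t := by
  intro t ht
  have := le_gronwallBound_of_liminf_deriv_right_le (f' := fun s => K * f s + ε) (δ := f 0)
    (K := K) (ε := ε) hf ?_ le_rfl (fun _ _ => le_rfl) t ht
  · simpa using this
  · intro x hx r hr
    have h1 : Tendsto (fun z => K * f x + ε + C * (z - x)) (𝓝[>] x) (𝓝 (K * f x + ε)) := by
      have : Tendsto (fun z => K * f x + ε + C * (z - x)) (𝓝 x) (𝓝 (K * f x + ε + C * (x - x))) :=
        Continuous.tendsto (by fun_prop) x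
      rw [sub_self, mul_zero, add_zero] at this
      exact this.mono_left nhdsWithin_le_nhds
    refine Eventually.frequently ?_
    filter_upwards [h1.eventually_lt_const hr, self_mem_nhdsWithin,
      Ioc_mem_nhdsGT hx.2] with z hz hz1 hz2
    have hpos : 0 < z - x := sub_pos.2 hz1
    have h2 := h x z hx.1 hz2.1.le hz2.2
    refine lt_of_le_of_lt ?_ hz
    rw [inv_mul_le_iff₀ hpos]
    nlinarith

/-- `x` solves `x' = B(t) x` for `t ≥ 0`, `x(0) = x₀`, in the sense of Carathéodory. -/
def IsLinearEvolution {H : Type*} [NormedAddCommGroup H] [NormedSpace ℝ H]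
    (B : ℝ → H →L[ℝ] H) (x₀ : H) (x : ℝ → H) : Prop :=
  ContinuousOn x (Ici 0) ∧
    ∀ t, 0 ≤ t → IntervalIntegrable (fun s => B s (x s)) volume 0 t ∧
      x t = x₀ + ∫ s in (0 : ℝ)..t, B s (x s)

/-- A uniformly bounded, strongly measurable family of operators. -/
structure IsBoundedFamily {H : Type*} [NormedAddCommGroup H] [NormedSpace ℝ H]
    (B : ℝ → H →L[ℝ] H) (M : ℝ) : Prop where
  stronglyMeasurable : ∀ v, StronglyMeasurable fun t => B t v
  norm_le : ∀ t, ‖B t‖ ≤ M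

namespace IsBoundedFamily

variable {H : Type*} [NormedAddCommGroup H] [NormedSpace ℝ H] {B : ℝ → H →L[ℝ] H} {M : ℝ}

theorem nonneg (hB : IsBoundedFamily B M) : 0 ≤ M := (norm_nonneg _).trans (hB.norm_le 0)

theorem norm_apply_le (hB : IsBoundedFamily B M) (t : ℝ) (v : H) : ‖B t v‖ ≤ M * ‖v‖ :=
  (B t).le_of_opNorm_le (hB.norm_le t) v

theorem comp_measurable (hB : IsBoundedFamily B M) {θ : ℝ → ℝ} (hθ : Measurable θ) :
    IsBoundedFamily (fun t => B (θ t)) M :=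
  ⟨fun v => (hB.stronglyMeasurable v).comp_measurable hθ, fun _ => hB.norm_le _⟩

/-- `(t, v) ↦ B t v` is a Carathéodory function: measurable in `t`, continuous in `v`. -/
theorem stronglyMeasurable_comp (hB : IsBoundedFamily B M) {y : ℝ → H} (hy : Continuous y) :
    StronglyMeasurable fun t => B t (y t) := by
  have h := stronglyMeasurable_uncurry_of_continuous_of_stronglyMeasurable
    (u := fun i r : ℝ => B r (y i)) (fun r => (B r).continuous.comp hy)
    (fun i => hB.stronglyMeasurable (y i))
  exact h.comp_measurable (measurable_id.prodMk measurable_id)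

theorem intervalIntegrable_of_continuousOn (hB : IsBoundedFamily B M) {y : ℝ → H} {a b : ℝ}
    (hab : a ≤ b) (hy : ContinuousOn y (Icc a b)) :
    IntervalIntegrable (fun t => B t (y t)) volume a b := by
  -- Extending `y` by constants outside the interval makes it globally continuous without changing
  -- the integrand on `Ioc a b`.
  have hc : Continuous (IccExtend hab ((Icc a b).domRestrict y)) := hy.domRestrict.Icc_extend'
  obtain ⟨R, hR⟩ := isCompact_Icc.exists_bound_of_continuousOn hy
  rw [intervalIntegrable_iff_integrableOn_Ioc_of_le hab]
  have hm : AEStronglyMeasurable (fun t => B t (y t)) (volume.restrict (Ioc a b)) := by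
    refine (hB.stronglyMeasurable_comp hc).aestronglyMeasurable.congr ?_
    filter_upwards [ae_restrict_mem measurableSet_Ioc] with t ht
    exact congrArg (B t) (IccExtend_of_mem hab _ (Ioc_subset_Icc_self ht))
  refine ⟨hm, .restrict_of_bounded (C := M * R) (by simp) ?_⟩
  filter_upwards [ae_restrict_mem measurableSet_Ioc] with t ht
  exact (hB.norm_apply_le t _).trans
    (mul_le_mul_of_nonneg_left (hR t (Ioc_subset_Icc_self ht)) hB.nonneg)

theorem intervalIntegrable_const (hB : IsBoundedFamily B M) (v : H) {a b : ℝ} (hab : a ≤ b) :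
    IntervalIntegrable (fun t => B t v) volume a b :=
  hB.intervalIntegrable_of_continuousOn hab continuousOn_const

/-- The terms of the Dyson series. -/
noncomputable def dyson (B : ℝ → H →L[ℝ] H) (x₀ : H) : ℕ → ℝ → H
  | 0 => fun _ => x₀
  | n + 1 => fun t => ∫ s in (0 : ℝ)..t, B s (dyson B x₀ n s)

theorem dyson_spec (hB : IsBoundedFamily B M) (x₀ : H) (n : ℕ) :
    ContinuousOn (dyson B x₀ n) (Ici 0) ∧
      ∀ t, 0 ≤ t → ‖dyson B x₀ n t‖ ≤ (M * t) ^ n / n.factorial * ‖x₀‖ := by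
  have hM := hB.nonneg
  induction n with
  | zero => exact ⟨continuousOn_const, fun t _ => by simp [dyson]⟩
  | succ n ih =>
    have hint : ∀ t, 0 ≤ t → IntervalIntegrable (fun s => B s (dyson B x₀ n s)) volume 0 t :=
      fun t ht => hB.intervalIntegrable_of_continuousOn ht (ih.1.mono Icc_subset_Ici_self)
    refine ⟨?_, fun t ht => ?_⟩
    · intro t ht
      have h1 : ContinuousOn (dyson B x₀ (n + 1)) (Icc 0 (t + 1)) := by
        have := intervalIntegral.continuousOn_primitive_interval (μ := volume)
          (f := fun s => B s (dyson B x₀ n s)) (a := 0) (b := t + 1)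
          (by
            have := (hint (t + 1) (by linarith [mem_Ici.1 ht]))
            rw [intervalIntegrable_iff_integrableOn_Icc_of_le (by linarith [mem_Ici.1 ht])] at this
            rwa [uIcc_of_le (by linarith [mem_Ici.1 ht])])
        rwa [uIcc_of_le (by linarith [mem_Ici.1 ht])] at this
      refine (h1 t ⟨ht, by linarith⟩).mono_of_mem_nhdsWithin ?_
      exact mem_nhdsWithin.2 ⟨Iio (t + 1), isOpen_Iio, by simp, fun z hz => ⟨hz.2, hz.1.le⟩⟩
    · have h2 : ‖dyson B x₀ (n + 1) t‖ ≤
          ∫ s in (0 : ℝ)..t, M * ((M * s) ^ n / n.factorial * ‖x₀‖) := by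
        refine intervalIntegral.norm_integral_le_of_norm_le ht
          (ae_of_all _ fun s hs => ?_) (Continuous.intervalIntegrable (by fun_prop) _ _)
        exact (hB.norm_apply_le s _).trans (mul_le_mul_of_nonneg_left (ih.2 s hs.1.le) hM)
      refine h2.trans (le_of_eq ?_)
      have h3 : (fun s : ℝ => M * ((M * s) ^ n / n.factorial * ‖x₀‖)) =
          fun s => (M ^ (n + 1) / n.factorial * ‖x₀‖) * s ^ n := by
        funext s; rw [mul_pow, pow_succ]; ring
      rw [h3, intervalIntegral.integral_const_mul, integral_pow, Nat.factorial_succ]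
      push_cast
      field_simp
      ring

/-- The Dyson series is dominated on bounded time intervals by an exponential series, so it
converges uniformly there and may be integrated term by term; the equation is then the shift of the
summation index. -/
theorem exists_isLinearEvolution [CompleteSpace H] (hB : IsBoundedFamily B M) (x₀ : H) :
    ∃ x, IsLinearEvolution B x₀ x := by
  have hM := hB.nonneg
  have hsum : ∀ t, 0 ≤ t → Summable fun n => ‖dyson B x₀ n t‖ := fun t ht =>
    Summable.of_nonneg_of_le (fun _ => norm_nonneg _) (fun n => (hB.dyson_spec x₀ n).2 t ht)
      ((Real.summable_pow_div_factorial (M * t)).mul_right _)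
  have hle : ∀ n s t, 0 ≤ s → s ≤ t →
      ‖dyson B x₀ n s‖ ≤ (M * t) ^ n / n.factorial * ‖x₀‖ := fun n s t hs hst =>
    ((hB.dyson_spec x₀ n).2 s hs).trans (by gcongr)
  set x : ℝ → H := fun t => ∑' n, dyson B x₀ n t with hx
  have hxc : ContinuousOn x (Ici 0) := by
    intro t ht
    have h1 : ContinuousOn x (Icc 0 (t + 1)) :=
      continuousOn_tsum (fun n => (hB.dyson_spec x₀ n).1.mono Icc_subset_Ici_self)
        ((Real.summable_pow_div_factorial (M * (t + 1))).mul_right ‖x₀‖)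
        (fun n s hs => hle n s _ hs.1 hs.2)
    refine (h1 t ⟨ht, by linarith⟩).mono_of_mem_nhdsWithin ?_
    exact mem_nhdsWithin.2 ⟨Iio (t + 1), isOpen_Iio, by simp, fun z hz => ⟨hz.2, hz.1.le⟩⟩
  refine ⟨x, hxc, fun t ht => ⟨hB.intervalIntegrable_of_continuousOn ht
    (hxc.mono Icc_subset_Ici_self), ?_⟩⟩
  have h2 : HasSum (fun n => ∫ s in (0 : ℝ)..t, B s (dyson B x₀ n s))
      (∫ s in (0 : ℝ)..t, B s (x s)) := by
    refine intervalIntegral.hasSum_integral_of_dominated_convergence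
      (fun n _ => M * ((M * t) ^ n / n.factorial * ‖x₀‖)) (fun n => ?_) (fun n => ?_) ?_ ?_ ?_
    · have := hB.intervalIntegrable_of_continuousOn ht
        ((hB.dyson_spec x₀ n).1.mono Icc_subset_Ici_self)
      rw [uIoc_of_le ht]
      exact this.1.aestronglyMeasurable
    · refine ae_of_all _ fun s hs => ?_
      rw [uIoc_of_le ht] at hs
      exact (hB.norm_apply_le s _).trans
        (mul_le_mul_of_nonneg_left (hle n s t hs.1.le hs.2) hM)
    · exact ae_of_all _ fun s _ =>
        ((Real.summable_pow_div_factorial (M * t)).mul_right _).mul_left _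
    · exact _root_.intervalIntegrable_const
    · refine ae_of_all _ fun s hs => ?_
      rw [uIoc_of_le ht] at hs
      exact (hsum s hs.1.le).of_norm.hasSum.mapL (B s)
  have h3 := (hsum t ht).of_norm.tsum_eq_zero_add
  rw [hx]
  simp only
  rw [h3, ← h2.tsum_eq]
  rfl

end IsBoundedFamily

namespace IsLinearEvolution

variable {H : Type*} [NormedAddCommGroup H] [NormedSpace ℝ H] {B : ℝ → H →L[ℝ] H} {M : ℝ}
  {x₀ y₀ : H} {x y : ℝ → H}

theorem apply_zero (hx : IsLinearEvolution B x₀ x) : x 0 = x₀ := by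
  simpa using (hx.2 0 le_rfl).2

theorem sub_eq_integral (hx : IsLinearEvolution B x₀ x) {s t : ℝ} (hs : 0 ≤ s) (ht : 0 ≤ t) :
    x t - x s = ∫ r in s..t, B r (x r) := by
  rw [(hx.2 t ht).2, (hx.2 s hs).2, add_sub_add_left_eq_sub]
  exact intervalIntegral.integral_interval_sub_left (hx.2 t ht).1 (hx.2 s hs).1

theorem sub (hx : IsLinearEvolution B x₀ x) (hy : IsLinearEvolution B y₀ y) :
    IsLinearEvolution B (x₀ - y₀) (fun t => x t - y t) := by
  refine ⟨hx.1.sub hy.1, fun t ht => ?_⟩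
  simp only [map_sub]
  refine ⟨(hx.2 t ht).1.sub (hy.2 t ht).1, ?_⟩
  rw [intervalIntegral.integral_sub (hx.2 t ht).1 (hy.2 t ht).1, (hx.2 t ht).2, (hy.2 t ht).2]
  abel

theorem shift (hx : IsLinearEvolution B x₀ x) {a : ℝ} (ha : 0 ≤ a) :
    IsLinearEvolution (fun t => B (t + a)) (x a) (fun t => x (t + a)) := by
  refine ⟨hx.1.comp (by fun_prop) fun t ht => add_nonneg (mem_Ici.1 ht) ha, fun t ht => ⟨?_, ?_⟩⟩
  · have h := ((hx.2 a ha).1.symm.trans (hx.2 (t + a) (by positivity)).1).comp_add_right a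
    simpa using h
  · rw [intervalIntegral.integral_comp_add_right (fun r => B r (x r)), zero_add,
      ← hx.sub_eq_integral ha (by positivity)]
    abel

/-- On bounded time intervals the increments are given by the frozen state up to a quadratic
error. -/
theorem exists_increment_bound (hB : IsBoundedFamily B M) (hx : IsLinearEvolution B x₀ x) (T : ℝ) :
    ∃ L, 0 ≤ L ∧ ∀ s t, 0 ≤ s → s ≤ t → t ≤ T → ‖x t - x s‖ ≤ L * (t - s) ∧
      ‖x t - x s - ∫ r in s..t, B r (x s)‖ ≤ L * (t - s) ^ 2 := by
  obtain ⟨R, hR⟩ := isCompact_Icc.exists_bound_of_continuousOn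
    (hx.1.mono (Icc_subset_Ici_self : Icc 0 T ⊆ Ici 0))
  have hM := hB.nonneg
  have hlip : ∀ s t, 0 ≤ s → s ≤ t → t ≤ T → ‖x t - x s‖ ≤ M * |R| * (t - s) := by
    intro s t hs hst ht
    rw [hx.sub_eq_integral hs (hs.trans hst)]
    have := intervalIntegral.norm_integral_le_of_norm_le_const (a := s) (b := t)
      (f := fun r => B r (x r)) (C := M * |R|) fun r hr => by
        rw [uIoc_of_le hst] at hr
        exact (hB.norm_apply_le r _).trans (mul_le_mul_of_nonneg_left
          ((hR r ⟨hs.trans hr.1.le, hr.2.trans ht⟩).trans (le_abs_self R)) hM)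
    rwa [abs_of_nonneg (sub_nonneg.2 hst)] at this
  have hint : ∀ s t, 0 ≤ s → s ≤ t → IntervalIntegrable (fun r => B r (x r)) volume s t :=
    fun s t hs hst => hB.intervalIntegrable_of_continuousOn hst
      (hx.1.mono fun r hr => hs.trans hr.1)
  have hfr : ∀ s t, 0 ≤ s → s ≤ t → t ≤ T →
      ‖x t - x s - ∫ r in s..t, B r (x s)‖ ≤ M * (M * |R|) * (t - s) ^ 2 := by
    intro s t hs hst ht
    rw [hx.sub_eq_integral hs (hs.trans hst), ← intervalIntegral.integral_sub (hint s t hs hst)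
      (hB.intervalIntegrable_const _ hst)]
    have := intervalIntegral.norm_integral_le_of_norm_le_const (a := s) (b := t)
      (f := fun r => B r (x r) - B r (x s)) (C := M * (M * |R| * (t - s))) fun r hr => by
        rw [uIoc_of_le hst] at hr
        rw [← map_sub]
        refine (hB.norm_apply_le r _).trans (mul_le_mul_of_nonneg_left ?_ hM)
        exact (hlip s r hs hr.1.le (hr.2.trans ht)).trans
          (mul_le_mul_of_nonneg_left (by linarith [hr.2]) (by positivity))
    rw [abs_of_nonneg (sub_nonneg.2 hst)] at this
    refine this.trans (le_of_eq (by ring))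
  refine ⟨M * |R| + M * (M * |R|), by positivity, fun s t hs hst ht => ⟨?_, ?_⟩⟩
  · refine (hlip s t hs hst ht).trans (mul_le_mul_of_nonneg_right ?_ (sub_nonneg.2 hst))
    linarith [show 0 ≤ M * (M * |R|) by positivity]
  · refine (hfr s t hs hst ht).trans (mul_le_mul_of_nonneg_right ?_ (sq_nonneg _))
    linarith [show 0 ≤ M * |R| by positivity]

end IsLinearEvolution

/-! ### Energy estimates and duality in Hilbert space -/

namespace IsLinearEvolution

variable {H : Type*} [NormedAddCommGroup H] [InnerProductSpace ℝ H] [CompleteSpace H]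
  {B : ℝ → H →L[ℝ] H} {M : ℝ} {x₀ y₀ : H} {x y : ℝ → H}

/-- Turns a bound on the generator at the frozen state into an increment bound of the form required
by `le_gronwallBound_of_quadratic_error`. The constant `L` precedes `g` and `c`, so the test vector
may depend on the current time `s`. -/
theorem exists_inner_increment_bound (hB : IsBoundedFamily B M) (hx : IsLinearEvolution B x₀ x)
    (T : ℝ) :
    ∃ L, 0 ≤ L ∧ (∀ s t, 0 ≤ s → s ≤ t → t ≤ T → ‖x t - x s‖ ≤ L * (t - s)) ∧
      ∀ s t, 0 ≤ s → s ≤ t → t ≤ T → ∀ (g : H) (c : ℝ), (∀ r, inner ℝ (B r (x s)) g ≤ c) →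
        inner ℝ (x t - x s) g ≤ c * (t - s) + L * ‖g‖ * (t - s) ^ 2 := by
  obtain ⟨L, hL, h⟩ := hx.exists_increment_bound hB T
  refine ⟨L, hL, fun s t hs hst ht => (h s t hs hst ht).1, fun s t hs hst ht g c hc => ?_⟩
  have h1 : inner ℝ (x t - x s - ∫ r in s..t, B r (x s)) g ≤ L * (t - s) ^ 2 * ‖g‖ :=
    (real_inner_le_norm _ _).trans
      (mul_le_mul_of_nonneg_right (h s t hs hst ht).2 (norm_nonneg _))
  have h2 : inner ℝ (∫ r in s..t, B r (x s)) g ≤ c * (t - s) := by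
    have hi := hB.intervalIntegrable_const (x s) hst
    have h3 : inner ℝ (∫ r in s..t, B r (x s)) g = ∫ r in s..t, inner ℝ g (B r (x s)) := by
      rw [real_inner_comm]
      exact ((innerSL ℝ g).intervalIntegral_comp_comm hi).symm
    have h4 : ∫ r in s..t, inner ℝ g (B r (x s)) ≤ ∫ _ in s..t, c :=
      intervalIntegral.integral_mono_on hst ⟨(innerSL ℝ g).integrable_comp hi.1, (innerSL ℝ g).integrable_comp hi.2⟩
        _root_.intervalIntegrable_const fun r _ => by rw [real_inner_comm]; exact hc r
    rw [h3]
    refine h4.trans (le_of_eq ?_)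
    rw [intervalIntegral.integral_const, smul_eq_mul, mul_comm]
  rw [inner_sub_left] at h1
  linarith

/-- Grönwall's inequality for a linear functional of the solution. -/
theorem inner_le_gronwallBound (hB : IsBoundedFamily B M) (hx : IsLinearEvolution B x₀ x)
    {T K ε : ℝ} (g : H) (h : ∀ r s, 0 ≤ s → s ≤ T →
      inner ℝ (B r (x s)) g ≤ K * inner ℝ (x s) g + ε) {t : ℝ} (ht0 : 0 ≤ t) (ht : t ≤ T) :
    inner ℝ (x t) g ≤ gronwallBound (inner ℝ x₀ g) K ε t := by
  obtain ⟨L, hL, -, h2⟩ := hx.exists_inner_increment_bound hB T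
  have := le_gronwallBound_of_quadratic_error (f := fun t => inner ℝ (x t) g) (T := T) (K := K)
    (ε := ε) (C := L * ‖g‖) ?_ ?_ t ⟨ht0, ht⟩
  · simpa [hx.apply_zero] using this
  · exact (hx.1.mono Icc_subset_Ici_self).inner continuousOn_const
  · intro s t hs hst ht
    have := h2 s t hs hst ht g _ fun r => h r s hs (hst.trans ht)
    rw [inner_sub_left] at this
    linarith

/-- Grönwall's inequality for the energy of the solution. -/
theorem norm_sq_le_gronwallBound (hB : IsBoundedFamily B M) (hx : IsLinearEvolution B x₀ x)
    {K ε : ℝ} (h : ∀ r s, 0 ≤ s → inner ℝ (B r (x s)) (x s) ≤ K * ‖x s‖ ^ 2 + ε)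
    {t : ℝ} (ht : 0 ≤ t) :
    ‖x t‖ ^ 2 ≤ gronwallBound (‖x₀‖ ^ 2) (2 * K) (2 * ε) t := by
  obtain ⟨L, hL, h1, h2⟩ := hx.exists_inner_increment_bound hB t
  obtain ⟨R, hR⟩ := isCompact_Icc.exists_bound_of_continuousOn
    (hx.1.mono (Icc_subset_Ici_self : Icc 0 t ⊆ Ici 0))
  have := le_gronwallBound_of_quadratic_error (f := fun t => ‖x t‖ ^ 2) (T := t) (K := 2 * K)
    (ε := 2 * ε) (C := 2 * (L * R) + L ^ 2) ?_ ?_ t ⟨ht, le_rfl⟩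
  · simpa [hx.apply_zero] using this
  · exact (hx.1.mono Icc_subset_Ici_self).norm.pow 2
  · intro s r hs hsr hr
    have e1 := h2 s r hs hsr hr (x s) _ fun r => h r s hs
    have e2 : ‖x r‖ ^ 2 = ‖x s‖ ^ 2 + 2 * inner ℝ (x r - x s) (x s) + ‖x r - x s‖ ^ 2 := by
      have := norm_add_sq_real (x r - x s) (x s)
      rw [sub_add_cancel] at this
      linarith
    have e3 : ‖x r - x s‖ ^ 2 ≤ (L * (r - s)) ^ 2 :=
      pow_le_pow_left₀ (norm_nonneg _) (h1 s r hs hsr hr) 2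
    have e4 : L * ‖x s‖ * (r - s) ^ 2 ≤ L * R * (r - s) ^ 2 := by
      gcongr
      exact hR s ⟨hs, hsr.trans hr⟩
    rw [e2]
    nlinarith

theorem eqOn (hB : IsBoundedFamily B M) (hx : IsLinearEvolution B x₀ x)
    (hy : IsLinearEvolution B x₀ y) {t : ℝ} (ht : 0 ≤ t) : x t = y t := by
  have h := (hx.sub hy).norm_sq_le_gronwallBound hB (K := M) (ε := 0) (fun r s _ => by
    have := (real_inner_le_norm (B r (x s - y s)) (x s - y s)).trans
      (mul_le_mul_of_nonneg_right (hB.norm_apply_le r _) (norm_nonneg _))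
    nlinarith) ht
  have h0 : gronwallBound (‖x₀ - x₀‖ ^ 2) (2 * M) (2 * 0) t = 0 := by
    unfold gronwallBound
    split_ifs <;> simp
  rw [h0] at h
  have : ‖x t - y t‖ = 0 := by nlinarith [norm_nonneg (x t - y t)]
  exact sub_eq_zero.1 (norm_eq_zero.1 this)

/-- The pairing of a forward solution with a backward solution of the adjoint equation is
constant. -/
theorem inner_duality {A : ℝ → H →L[ℝ] H} (hA : IsBoundedFamily A M) {T : ℝ} (hT : 0 ≤ T)
    (hA' : IsBoundedFamily (fun t => ContinuousLinearMap.adjoint (A (T - t))) M)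
    (hx : IsLinearEvolution A x₀ x)
    (hy : IsLinearEvolution (fun t => ContinuousLinearMap.adjoint (A (T - t))) y₀ y) :
    inner ℝ (x T) y₀ = inner ℝ x₀ (y T) := by
  obtain ⟨L, hL, h1⟩ := hx.exists_increment_bound hA T
  obtain ⟨L', hL', h1'⟩ := hy.exists_increment_bound hA' T
  obtain ⟨R, hR⟩ := isCompact_Icc.exists_bound_of_continuousOn
    (hx.1.mono (Icc_subset_Ici_self : Icc 0 T ⊆ Ici 0))
  obtain ⟨R', hR'⟩ := isCompact_Icc.exists_bound_of_continuousOn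
    (hy.1.mono (Icc_subset_Ici_self : Icc 0 T ⊆ Ici 0))
  -- The first order parts cancel when the forward increment is frozen at `x s` and the backward one
  -- at `y (T - t)`; this is `e4`, the definition of the adjoint after the substitution `r ↦ T - r`.
  have key : ∀ s t, 0 ≤ s → s ≤ t → t ≤ T →
      |inner ℝ (x t) (y (T - t)) - inner ℝ (x s) (y (T - s))| ≤ (L * R' + R * L') * (t - s) ^ 2 := by
    intro s t hs hst ht
    have e1 := (h1 s t hs hst ht).2
    have e2 := (h1' (T - t) (T - s) (by linarith) (by linarith) (by linarith)).2
    have e3 : T - s - (T - t) = t - s := by ring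
    rw [e3] at e2
    have hi := hA.intervalIntegrable_const (x s) hst
    have hi' := hA'.intervalIntegrable_const (y (T - t)) (show T - t ≤ T - s by linarith)
    have e4 : inner ℝ (∫ r in s..t, A r (x s)) (y (T - t)) =
        inner ℝ (x s) (∫ r in (T - t)..(T - s),
          ContinuousLinearMap.adjoint (A (T - r)) (y (T - t))) := by
      have f1 : inner ℝ (∫ r in s..t, A r (x s)) (y (T - t)) =
          ∫ r in s..t, inner ℝ (y (T - t)) (A r (x s)) := by
        rw [real_inner_comm]
        exact ((innerSL ℝ _).intervalIntegral_comp_comm hi).symm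
      have f2 : inner ℝ (x s) (∫ r in (T - t)..(T - s),
          ContinuousLinearMap.adjoint (A (T - r)) (y (T - t))) = ∫ r in (T - t)..(T - s),
          inner ℝ (x s) (ContinuousLinearMap.adjoint (A (T - r)) (y (T - t))) :=
        ((innerSL ℝ _).intervalIntegral_comp_comm hi').symm
      rw [f1, f2, intervalIntegral.integral_comp_sub_left
        (fun r => inner ℝ (x s) (ContinuousLinearMap.adjoint (A r) (y (T - t)))), sub_sub_cancel,
        sub_sub_cancel]
      refine intervalIntegral.integral_congr fun r _ => ?_
      rw [ContinuousLinearMap.adjoint_inner_right, real_inner_comm]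
    have e5 : inner ℝ (x t) (y (T - t)) - inner ℝ (x s) (y (T - s)) =
        inner ℝ (x t - x s - ∫ r in s..t, A r (x s)) (y (T - t)) -
        inner ℝ (x s) (y (T - s) - y (T - t) - ∫ r in (T - t)..(T - s),
          ContinuousLinearMap.adjoint (A (T - r)) (y (T - t))) := by
      rw [inner_sub_left, inner_sub_right (x s), e4, inner_sub_left, inner_sub_right]
      ring
    rw [e5]
    refine (abs_sub _ _).trans ?_
    have g1 := (abs_real_inner_le_norm (x t - x s - ∫ r in s..t, A r (x s)) (y (T - t))).trans
      (mul_le_mul e1 (hR' (T - t) ⟨by linarith, by linarith⟩) (norm_nonneg _) (by positivity))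
    have g2 := (abs_real_inner_le_norm (x s) (y (T - s) - y (T - t) - ∫ r in (T - t)..(T - s),
          ContinuousLinearMap.adjoint (A (T - r)) (y (T - t)))).trans
      (mul_le_mul (hR s ⟨hs, by linarith⟩) e2 (norm_nonneg _)
        ((norm_nonneg _).trans (hR s ⟨hs, by linarith⟩)))
    calc _ ≤ L * (t - s) ^ 2 * R' + R * (L' * (t - s) ^ 2) := add_le_add g1 g2
      _ = _ := by ring
  have hcont : ContinuousOn (fun t => inner ℝ (x t) (y (T - t))) (Icc 0 T) :=
    (hx.1.mono Icc_subset_Ici_self).inner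
      (hy.1.comp (by fun_prop) fun t ht => by simpa using ht.2)
  -- A function whose increments are quadratically small is constant: Grönwall with zero rate, for
  -- the pairing and for its negative.
  have u1 := le_gronwallBound_of_quadratic_error (K := 0) (ε := 0) (C := L * R' + R * L') hcont
    (fun s t hs hst ht => by have := (abs_le.1 (key s t hs hst ht)).2; linarith) T ⟨hT, le_rfl⟩
  have u2 := le_gronwallBound_of_quadratic_error (K := 0) (ε := 0) (C := L * R' + R * L') hcont.neg
    (fun s t hs hst ht => by
      have := (abs_le.1 (key s t hs hst ht)).1
      simp only [Pi.neg_apply]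
      linarith) T ⟨hT, le_rfl⟩
  simp only [Pi.neg_apply, gronwallBound_K0, sub_self, sub_zero, hx.apply_zero, hy.apply_zero] at u1 u2
  linarith

end IsLinearEvolution

end Evolution

/-! ### Uniform ergodicity of positive mass preserving evolutions in `L²` -/

/-! ### The order of `L²` seen through the inner product -/

section Order

variable {X : Type*} [MeasurableSpace X] {m : Measure X}

theorem Lp_inner_eq_integral (v g : Lp ℝ 2 m) : inner ℝ v g = ∫ ξ, v ξ * g ξ ∂m := by
  rw [L2.inner_def]
  exact integral_congr_ae (Filter.Eventually.of_forall fun ξ => by simp [mul_comm])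

theorem Lp_inner_nonneg {v g : Lp ℝ 2 m} (hv : 0 ≤ v) (hg : 0 ≤ g) : 0 ≤ inner ℝ v g := by
  rw [Lp_inner_eq_integral]
  refine integral_nonneg_of_ae ?_
  filter_upwards [(Lp.coeFn_nonneg v).2 hv, (Lp.coeFn_nonneg g).2 hg] with ξ h1 h2
  exact mul_nonneg h1 h2

theorem Lp_inner_mono_left {v w g : Lp ℝ 2 m} (hvw : v ≤ w) (hg : 0 ≤ g) :
    inner ℝ v g ≤ inner ℝ w g := by
  have := Lp_inner_nonneg (sub_nonneg.2 hvw) hg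
  rw [inner_sub_left] at this
  linarith

theorem Lp_inner_posPart_negPart (v : Lp ℝ 2 m) : inner ℝ v⁺ v⁻ = 0 := by
  rw [Lp_inner_eq_integral]
  refine integral_eq_zero_of_ae ?_
  filter_upwards [Lp.coeFn_sup v 0, Lp.coeFn_sup (-v) 0, Lp.coeFn_neg v,
    Lp.coeFn_zero ℝ 2 m] with ξ h1 h2 h3 h4
  rw [posPart_def, negPart_def, h1, h2]
  simp only [Pi.sup_apply, h3, h4, Pi.neg_apply, Pi.zero_apply]
  rcases le_total (v ξ) 0 with h | h
  · rw [sup_of_le_right h, zero_mul]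
  · rw [sup_of_le_right (neg_nonpos.2 h), mul_zero]

theorem Lp_inner_negPart (v : Lp ℝ 2 m) : inner ℝ v v⁻ = -‖v⁻‖ ^ 2 := by
  conv_lhs => rw [← posPart_sub_negPart v]
  rw [inner_sub_left]
  simp only [posPart_sub_negPart, Lp_inner_posPart_negPart, real_inner_self_eq_norm_sq, zero_sub]

/-- Testing with `v⁻` gives `-‖v⁻‖² ≥ 0`. Through this criterion order inequalities between
solutions reduce to scalar Grönwall inequalities. -/
theorem Lp_nonneg_of_inner {v : Lp ℝ 2 m} (h : ∀ g : Lp ℝ 2 m, 0 ≤ g → 0 ≤ inner ℝ v g) :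
    0 ≤ v := by
  have h1 := h v⁻ (negPart_nonneg v)
  rw [Lp_inner_negPart] at h1
  have h2 : ‖v⁻‖ = 0 := by nlinarith [norm_nonneg v⁻]
  exact negPart_eq_zero.1 (norm_eq_zero.1 h2)

theorem Lp_le_of_inner {v w : Lp ℝ 2 m}
    (h : ∀ g : Lp ℝ 2 m, 0 ≤ g → inner ℝ v g ≤ inner ℝ w g) : v ≤ w :=
  sub_nonneg.1 <| Lp_nonneg_of_inner fun g hg => by
    rw [inner_sub_left]; exact sub_nonneg.2 (h g hg)

theorem Lp_smul_nonneg {c : ℝ} (hc : 0 ≤ c) {v : Lp ℝ 2 m} (hv : 0 ≤ v) : 0 ≤ c • v :=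
  Lp_nonneg_of_inner fun g hg => by
    rw [real_inner_smul_left]; exact mul_nonneg hc (Lp_inner_nonneg hv hg)

theorem Lp_smul_mono {c : ℝ} (hc : 0 ≤ c) {v w : Lp ℝ 2 m} (h : v ≤ w) : c • v ≤ c • w := by
  have := Lp_smul_nonneg hc (sub_nonneg.2 h)
  rwa [smul_sub, sub_nonneg] at this

/-- `‖v⁻‖` is the distance from `v` to the cone of nonnegative functions. -/
theorem Lp_norm_negPart_le (v : Lp ℝ 2 m) {w : Lp ℝ 2 m} (hw : 0 ≤ w) : ‖v⁻‖ ≤ ‖v - w‖ := by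
  refine norm_le_norm_of_abs_le_abs ?_
  rw [abs_of_nonneg (negPart_nonneg v), negPart_def]
  refine sup_le ?_ (abs_nonneg _)
  calc -v ≤ w - v := by simpa using hw
    _ ≤ |v - w| := by rw [abs_sub_comm]; exact le_abs_self _

/-- The total mass of `|v|`. -/
noncomputable def absMass [IsFiniteMeasure m] (v : Lp ℝ 2 m) : ℝ := inner ℝ |v| (Lp.const 2 m 1)

theorem Lp_const_one_nonneg [IsFiniteMeasure m] : 0 ≤ (Lp.const 2 m (1 : ℝ)) := by
  rw [← Lp.coeFn_nonneg]
  filter_upwards [Lp.coeFn_const (p := 2) (μ := m) (1 : ℝ)] with ξ h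
  rw [h]
  simp

theorem Lp_inner_const_one [IsFiniteMeasure m] (v : Lp ℝ 2 m) :
    inner ℝ v (Lp.const 2 m 1) = ∫ ξ, v ξ ∂m := by
  rw [Lp_inner_eq_integral]
  refine integral_congr_ae ?_
  filter_upwards [Lp.coeFn_const (p := 2) (μ := m) (1 : ℝ)] with ξ h
  rw [h]
  simp

theorem absMass_nonneg [IsFiniteMeasure m] (v : Lp ℝ 2 m) : 0 ≤ absMass v :=
  Lp_inner_nonneg (abs_nonneg v) Lp_const_one_nonneg

theorem Lp_norm_const_one [IsProbabilityMeasure m] : ‖Lp.const 2 m (1 : ℝ)‖ = 1 := by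
  rw [Lp.norm_const] <;> simp

theorem absMass_le_norm [IsProbabilityMeasure m] (v : Lp ℝ 2 m) : absMass v ≤ ‖v‖ := by
  have := real_inner_le_norm |v| (Lp.const 2 m (1 : ℝ))
  rwa [Lp_norm_const_one, mul_one, norm_abs_eq_norm] at this

end Order

/-! ### Doeblin families: positivity, minorization and decay -/

/-- A bounded family of generators of positive mass preserving evolutions that dominates the
positive operator `S` and is dissipative in `L²` up to the `L¹` norm. -/
structure IsDoeblinFamily {X : Type*} [MeasurableSpace X] {m : Measure X} [IsProbabilityMeasure m]
    (S : Lp ℝ 2 m →L[ℝ] Lp ℝ 2 m) (M α₁ α c K : ℝ) (B : ℝ → Lp ℝ 2 m →L[ℝ] Lp ℝ 2 m) : Prop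
    extends IsBoundedFamily B M where
  mass : ∀ t v, inner ℝ (B t v) (Lp.const 2 m (1 : ℝ)) = 0
  lower : ∀ t v, 0 ≤ v → α₁ • S v ≤ B t v + α • v
  dissipative : ∀ t v, inner ℝ (B t v) v ≤ -c * ‖v‖ ^ 2 + K * absMass v ^ 2

namespace IsDoeblinFamily

variable {X : Type*} [MeasurableSpace X] {m : Measure X} [IsProbabilityMeasure m]
  {S : Lp ℝ 2 m →L[ℝ] Lp ℝ 2 m} {M α₁ α c K : ℝ} {B : ℝ → Lp ℝ 2 m →L[ℝ] Lp ℝ 2 m}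
  {x₀ : Lp ℝ 2 m} {x : ℝ → Lp ℝ 2 m}

theorem shift (hB : IsDoeblinFamily S M α₁ α c K B) (a : ℝ) :
    IsDoeblinFamily S M α₁ α c K fun t => B (t + a) :=
  ⟨hB.1.comp_measurable (by fun_prop), fun _ => hB.mass _, fun _ => hB.lower _,
    fun _ => hB.dissipative _⟩

theorem mass_eq (hB : IsDoeblinFamily S M α₁ α c K B) (hx : IsLinearEvolution B x₀ x) {t : ℝ}
    (ht : 0 ≤ t) : inner ℝ (x t) (Lp.const 2 m (1 : ℝ)) = inner ℝ x₀ (Lp.const 2 m (1 : ℝ)) := by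
  have h1 := hx.inner_le_gronwallBound hB.1 (K := 0) (ε := 0) (Lp.const 2 m (1 : ℝ))
    (fun r s _ _ => by rw [hB.mass]; simp) ht le_rfl
  have h2 := hx.inner_le_gronwallBound hB.1 (K := 0) (ε := 0) (-Lp.const 2 m (1 : ℝ))
    (fun r s _ _ => by rw [inner_neg_right, hB.mass]; simp) ht le_rfl
  simp only [gronwallBound_K0, inner_neg_right] at h1 h2
  linarith

theorem nonneg_apply_add (hB : IsDoeblinFamily S M α₁ α c K B) (hα₁ : 0 ≤ α₁)
    (hS : ∀ v, 0 ≤ v → 0 ≤ S v) (t : ℝ) {v : Lp ℝ 2 m} (hv : 0 ≤ v) : 0 ≤ B t v + α • v :=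
  (Lp_smul_nonneg hα₁ (hS v hv)).trans (hB.lower t v hv)

/-- The energy of the negative part starts at zero and satisfies, in integrated form, `(‖x⁻‖²)' ≤ 2
M ‖x⁻‖²`. -/
theorem evolution_nonneg (hB : IsDoeblinFamily S M α₁ α c K B) (hα₁ : 0 ≤ α₁)
    (hS : ∀ v, 0 ≤ v → 0 ≤ S v) (hx : IsLinearEvolution B x₀ x) (h0 : 0 ≤ x₀) {t : ℝ}
    (ht : 0 ≤ t) : 0 ≤ x t := by
  obtain ⟨L, hL, h1, h2⟩ := hx.exists_inner_increment_bound hB.1 t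
  obtain ⟨R, hR⟩ := isCompact_Icc.exists_bound_of_continuousOn
    (hx.1.mono (Icc_subset_Ici_self : Icc 0 t ⊆ Ici 0))
  have hneg : ∀ v w : Lp ℝ 2 m, ‖v⁻‖ ≤ ‖w⁻‖ + ‖v - w‖ := by
    intro v w
    refine (Lp_norm_negPart_le v (posPart_nonneg w)).trans ?_
    have : v - w⁺ = -w⁻ + (v - w) := by
      rw [show w⁺ = w + w⁻ by rw [← sub_eq_iff_eq_add, posPart_sub_negPart]]
      abel
    rw [this]
    exact (norm_add_le _ _).trans (by rw [norm_neg])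
  have key := le_gronwallBound_of_quadratic_error (f := fun t => ‖(x t)⁻‖ ^ 2) (T := t)
    (K := 2 * M) (ε := 0) (C := 2 * (L * R) + L ^ 2) ?_ ?_ t ⟨ht, le_rfl⟩
  · have h0' : ‖(x 0)⁻‖ ^ 2 = 0 := by
      rw [hx.apply_zero, negPart_eq_zero.2 h0]; simp
    have hz : gronwallBound (‖(x 0)⁻‖ ^ 2) (2 * M) 0 t = 0 := by
      rw [h0']; unfold gronwallBound; split_ifs <;> simp
    rw [hz] at key
    have : ‖(x t)⁻‖ = 0 := by nlinarith [norm_nonneg (x t)⁻]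
    exact negPart_eq_zero.1 (norm_eq_zero.1 this)
  · have hlip : LipschitzWith 1 fun v : Lp ℝ 2 m => ‖v⁻‖ := LipschitzWith.of_le_add fun v w => by
      rw [dist_eq_norm]; exact hneg v w
    exact (hlip.continuous.comp_continuousOn (hx.1.mono Icc_subset_Ici_self)).pow 2
  · intro s r hs hsr hr
    -- Since `B x⁺ + α x⁺ ≥ 0` and `x⁺` is orthogonal to `x⁻`, the positive part contributes with a
    -- favourable sign and only `⟨B x⁻, x⁻⟩` has to be bounded.
    have e1 := h2 s r hs hsr hr (-(x s)⁻) (M * ‖(x s)⁻‖ ^ 2) fun ρ => by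
      have f1 := Lp_inner_nonneg (hB.nonneg_apply_add hα₁ hS ρ (posPart_nonneg (x s)))
        (negPart_nonneg (x s))
      rw [inner_add_left, real_inner_smul_left, Lp_inner_posPart_negPart, mul_zero, add_zero] at f1
      have f2 := (real_inner_le_norm (B ρ (x s)⁻) (x s)⁻).trans
        (mul_le_mul_of_nonneg_right (hB.norm_apply_le ρ _) (norm_nonneg _))
      have f3 : B ρ (x s) = B ρ (x s)⁺ - B ρ (x s)⁻ := by
        rw [← map_sub, posPart_sub_negPart]
      rw [f3, inner_neg_right, inner_sub_left]
      nlinarith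
    rw [norm_neg, inner_neg_right] at e1
    -- The negative part at time `r` is bounded by the distance to the fixed nonnegative element `(x
    -- s)⁺`, whose square expands exactly in the increment.
    have e2 : ‖(x r)⁻‖ ^ 2 ≤ ‖x r - x s - (x s)⁻‖ ^ 2 := by
      refine pow_le_pow_left₀ (norm_nonneg _) ?_ 2
      refine (Lp_norm_negPart_le (x r) (posPart_nonneg (x s))).trans (le_of_eq ?_)
      rw [show (x s)⁺ = x s + (x s)⁻ by rw [← sub_eq_iff_eq_add, posPart_sub_negPart], sub_sub]
    rw [norm_sub_sq_real] at e2
    have e3 : ‖x r - x s‖ ^ 2 ≤ (L * (r - s)) ^ 2 :=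
      pow_le_pow_left₀ (norm_nonneg _) (h1 s r hs hsr hr) 2
    have e4 : L * ‖(x s)⁻‖ * (r - s) ^ 2 ≤ L * R * (r - s) ^ 2 := by
      gcongr
      refine le_trans ?_ (hR s ⟨hs, hsr.trans hr⟩)
      simpa using Lp_norm_negPart_le (x s) le_rfl
    nlinarith

/-- Positivity of `B + α` on nonnegative states means `x' ≥ -α x`. -/
theorem exp_smul_le (hB : IsDoeblinFamily S M α₁ α c K B) (hα₁ : 0 ≤ α₁) (hα : 0 < α)
    (hS : ∀ v, 0 ≤ v → 0 ≤ S v) (hx : IsLinearEvolution B x₀ x) (h0 : 0 ≤ x₀) {t : ℝ}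
    (ht : 0 ≤ t) : Real.exp (-α * t) • x₀ ≤ x t := by
  refine Lp_le_of_inner fun g hg => ?_
  have h1 := hx.inner_le_gronwallBound hB.1 (K := -α) (ε := 0) (-g) (fun r s hs _ => by
    have := Lp_inner_nonneg
      (hB.nonneg_apply_add hα₁ hS r (hB.evolution_nonneg hα₁ hS hx h0 hs)) hg
    rw [inner_add_left, real_inner_smul_left] at this
    rw [inner_neg_right, inner_neg_right]
    linarith) ht le_rfl
  rw [gronwallBound_of_K_ne_0 (neg_ne_zero.2 hα.ne')] at h1
  simp only [inner_neg_right, zero_div, zero_mul, add_zero] at h1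
  rw [real_inner_smul_left]
  linarith

/-- The coefficient of the lower bound after a unit of time. -/
noncomputable def unitGain (α₁ α : ℝ) : ℝ :=
  α₁ * Real.exp (-α) / α * (1 - Real.exp (-α))

theorem unitGain_pos (hα₁ : 0 < α₁) (hα : 0 < α) : 0 < unitGain α₁ α := by
  have : Real.exp (-α) < 1 := by rw [Real.exp_lt_one_iff]; linarith
  have : 0 < 1 - Real.exp (-α) := by linarith
  unfold unitGain
  positivity

/-- On `[0, 1]` the previous bound gives `S x ≥ exp (-α) S x₀`, so `x' ≥ -α x + α₁ exp (-α) S x₀`;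
integrating this over unit time, with the nonnegative contribution of `x₀` dropped, produces
`unitGain`. -/
theorem unitGain_smul_le (hB : IsDoeblinFamily S M α₁ α c K B) (hα₁ : 0 ≤ α₁) (hα : 0 < α)
    (hS : ∀ v, 0 ≤ v → 0 ≤ S v) (hx : IsLinearEvolution B x₀ x) (h0 : 0 ≤ x₀) :
    unitGain α₁ α • S x₀ ≤ x 1 := by
  refine Lp_le_of_inner fun g hg => ?_
  have hSg := Lp_inner_nonneg (hS x₀ h0) hg
  have h1 := hx.inner_le_gronwallBound hB.1 (T := 1) (K := -α)
    (ε := -(α₁ * (Real.exp (-α) * inner ℝ (S x₀) g))) (-g) (fun r s hs hs1 => by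
    have hxs := hB.evolution_nonneg hα₁ hS hx h0 hs
    have e1 := Lp_inner_mono_left (hB.lower r _ hxs) hg
    have e2 : Real.exp (-α * s) • S x₀ ≤ S (x s) := by
      have := hS _ (sub_nonneg.2 (hB.exp_smul_le hα₁ hα hS hx h0 hs))
      rwa [map_sub, map_smul, sub_nonneg] at this
    have e3 := Lp_inner_mono_left e2 hg
    rw [real_inner_smul_left] at e3
    have e4 : Real.exp (-α) ≤ Real.exp (-α * s) := by
      rw [Real.exp_le_exp]; nlinarith
    have e5 := mul_le_mul_of_nonneg_right e4 hSg
    have e6 := mul_le_mul_of_nonneg_left (e5.trans e3) hα₁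
    rw [inner_add_left, real_inner_smul_left, real_inner_smul_left] at e1
    rw [inner_neg_right, inner_neg_right]
    linarith) zero_le_one le_rfl
  rw [gronwallBound_of_K_ne_0 (neg_ne_zero.2 hα.ne')] at h1
  simp only [inner_neg_right, mul_one] at h1
  have h2 := Lp_inner_nonneg h0 hg
  have h3 : 0 ≤ inner ℝ x₀ g * Real.exp (-α) := by positivity
  have h4 : -(α₁ * (Real.exp (-α) * inner ℝ (S x₀) g)) / -α * (Real.exp (-α) - 1) =
      -(unitGain α₁ α * inner ℝ (S x₀) g) := by
    unfold unitGain
    field_simp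
    ring
  rw [h4] at h1
  rw [real_inner_smul_left]
  linarith

/-- Iterates the bound for unit time. The family is quantified inside the induction because the
evolution is restarted at time `1` with shifted coefficients. -/
theorem pow_smul_le (hα₁ : 0 < α₁) (hα : 0 < α) (hS : ∀ v, 0 ≤ v → 0 ≤ S v) (n : ℕ) :
    ∀ {B : ℝ → Lp ℝ 2 m →L[ℝ] Lp ℝ 2 m} {x₀ : Lp ℝ 2 m} {x : ℝ → Lp ℝ 2 m},
      IsDoeblinFamily S M α₁ α c K B → IsLinearEvolution B x₀ x → 0 ≤ x₀ →
      unitGain α₁ α ^ n • (S ^ n) x₀ ≤ x n := by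
  induction n with
  | zero => intro B x₀ x hB hx h0; simp [hx.apply_zero]
  | succ n ih =>
    intro B x₀ x hB hx h0
    have h1 := ih (hB.shift 1) (hx.shift zero_le_one)
      (hB.evolution_nonneg hα₁.le hS hx h0 zero_le_one)
    have hSn : ∀ (k : ℕ) (v : Lp ℝ 2 m), 0 ≤ v → 0 ≤ (S ^ k) v := by
      intro k
      induction k with
      | zero => intro v hv; simpa using hv
      | succ k ihk => intro v hv; rw [pow_succ]; exact ihk _ (hS v hv)
    have h2 := hSn n _ (sub_nonneg.2 (hB.unitGain_smul_le hα₁.le hα hS hx h0))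
    rw [map_sub, map_smul, sub_nonneg] at h2
    have h3 := Lp_smul_mono (pow_nonneg (unitGain_pos hα₁ hα).le n) h2
    rw [smul_smul, ← pow_succ] at h3
    have h4 : (S ^ (n + 1)) x₀ = (S ^ n) (S x₀) := by rw [pow_succ]; rfl
    rw [h4, Nat.cast_succ]
    exact h3.trans h1

theorem exists_decomposition (hB : IsDoeblinFamily S M α₁ α c K B) (hα₁ : 0 ≤ α₁)
    (hS : ∀ v, 0 ≤ v → 0 ≤ S v) (hx : IsLinearEvolution B x₀ x) :
    ∃ y z : ℝ → Lp ℝ 2 m, IsLinearEvolution B x₀⁺ y ∧ IsLinearEvolution B x₀⁻ z ∧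
      ∀ t, 0 ≤ t → 0 ≤ y t ∧ 0 ≤ z t ∧ x t = y t - z t := by
  obtain ⟨y, hy⟩ := hB.1.exists_isLinearEvolution x₀⁺
  obtain ⟨z, hz⟩ := hB.1.exists_isLinearEvolution x₀⁻
  have h := hy.sub hz
  rw [posPart_sub_negPart] at h
  exact ⟨y, z, hy, hz, fun t ht => ⟨hB.evolution_nonneg hα₁ hS hy (posPart_nonneg _) ht,
    hB.evolution_nonneg hα₁ hS hz (negPart_nonneg _) ht, hx.eqOn hB.1 h ht⟩⟩

theorem absMass_eq_add (v : Lp ℝ 2 m) : absMass v =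
    inner ℝ v⁺ (Lp.const 2 m (1 : ℝ)) + inner ℝ v⁻ (Lp.const 2 m (1 : ℝ)) := by
  rw [absMass, ← posPart_add_negPart v, inner_add_left]

/-- The positive and negative parts evolve separately into `y, z ≥ 0` of conserved mass, and `|y -
z| ≤ y + z`. -/
theorem absMass_le (hB : IsDoeblinFamily S M α₁ α c K B) (hα₁ : 0 ≤ α₁)
    (hS : ∀ v, 0 ≤ v → 0 ≤ S v) (hx : IsLinearEvolution B x₀ x) {t : ℝ} (ht : 0 ≤ t) :
    absMass (x t) ≤ absMass x₀ := by
  obtain ⟨y, z, hy, hz, h⟩ := hB.exists_decomposition hα₁ hS hx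
  obtain ⟨h1, h2, h3⟩ := h t ht
  rw [absMass_eq_add x₀, ← hB.mass_eq hy ht, ← hB.mass_eq hz ht, ← inner_add_left, h3]
  refine Lp_inner_mono_left (sup_le ?_ ?_) Lp_const_one_nonneg
  · exact (sub_le_self _ h2).trans (le_add_of_nonneg_right h2)
  · rw [neg_sub]
    exact (sub_le_self _ h1).trans (le_add_of_nonneg_left h1)

/-- Doeblin's coupling: for mean zero data the two parts have equal mass, so both evolve above the
same multiple `q` of the constant. It cancels in the difference, and `|x n| ≤ (y n - q) + (z n -
q)`. -/
theorem absMass_le_of_mass_eq_zero (hB : IsDoeblinFamily S M α₁ α c K B) (hα₁ : 0 < α₁)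
    (hα : 0 < α) (hS : ∀ v, 0 ≤ v → 0 ≤ S v) {n : ℕ} {δ : ℝ}
    (hn : ∀ v, 0 ≤ v → (δ * inner ℝ v (Lp.const 2 m (1 : ℝ))) • Lp.const 2 m (1 : ℝ) ≤ (S ^ n) v)
    (hx : IsLinearEvolution B x₀ x) (h0 : inner ℝ x₀ (Lp.const 2 m (1 : ℝ)) = 0) :
    absMass (x n) ≤ (1 - unitGain α₁ α ^ n * δ) * absMass x₀ := by
  obtain ⟨y, z, hy, hz, h⟩ := hB.exists_decomposition hα₁.le hS hx
  obtain ⟨h1, h2, h3⟩ := h n n.cast_nonneg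
  set e : Lp ℝ 2 m := Lp.const 2 m (1 : ℝ) with he
  have hee : inner ℝ e e = 1 := by
    rw [real_inner_self_eq_norm_sq, he, Lp_norm_const_one, one_pow]
  have heq : inner ℝ x₀⁺ e = inner ℝ x₀⁻ e := by
    rw [← posPart_sub_negPart x₀, inner_sub_left] at h0
    linarith
  have hg := (unitGain_pos hα₁ hα).le
  set κ := unitGain α₁ α ^ n with hκ
  have low : ∀ {w₀ : Lp ℝ 2 m} {w : ℝ → Lp ℝ 2 m}, IsLinearEvolution B w₀ w → 0 ≤ w₀ →
      (κ * (δ * inner ℝ w₀ e)) • e ≤ w n := fun {w₀ w} hw hw0 => by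
    have := Lp_smul_mono (pow_nonneg hg n) (hn w₀ hw0)
    rw [smul_smul] at this
    exact this.trans (pow_smul_le hα₁ hα hS n hB hw hw0)
  have ly := low hy (posPart_nonneg _)
  have lz := low hz (negPart_nonneg _)
  rw [← heq] at lz
  set q := (κ * (δ * inner ℝ x₀⁺ e)) • e with hq
  have h4 : absMass (x n) ≤ inner ℝ (y n - q + (z n - q)) e := by
    refine Lp_inner_mono_left ?_ Lp_const_one_nonneg
    have f1 : x n = (y n - q) - (z n - q) := by rw [h3]; abel
    rw [f1]
    refine sup_le ?_ ?_
    · exact (sub_le_self _ (sub_nonneg.2 lz)).trans (le_add_of_nonneg_right (sub_nonneg.2 lz))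
    · rw [neg_sub]
      exact (sub_le_self _ (sub_nonneg.2 ly)).trans (le_add_of_nonneg_left (sub_nonneg.2 ly))
  rw [inner_add_left, inner_sub_left, inner_sub_left, hB.mass_eq hy n.cast_nonneg,
    hB.mass_eq hz n.cast_nonneg, hq, real_inner_smul_left, hee] at h4
  rw [absMass_eq_add x₀, ← he, ← heq]
  rw [← he, ← heq] at h4
  refine h4.trans (le_of_eq (by ring))

/-- As the `L¹` norm does not grow, the term `K * absMass ^ 2` in the dissipation inequality acts as
a constant source. -/
theorem norm_sq_le (hB : IsDoeblinFamily S M α₁ α c K B) (hα₁ : 0 ≤ α₁) (hc : 0 < c)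
    (hK : 0 ≤ K) (hS : ∀ v, 0 ≤ v → 0 ≤ S v) (hx : IsLinearEvolution B x₀ x) {t : ℝ}
    (ht : 0 ≤ t) :
    ‖x t‖ ^ 2 ≤ Real.exp (-(2 * c) * t) * ‖x₀‖ ^ 2 + K / c * absMass x₀ ^ 2 := by
  have h1 := hx.norm_sq_le_gronwallBound hB.1 (K := -c) (ε := K * absMass x₀ ^ 2)
    (fun r s hs => (hB.dissipative r _).trans (by
      have := pow_le_pow_left₀ (absMass_nonneg _) (hB.absMass_le hα₁ hS hx hs) 2
      have := mul_le_mul_of_nonneg_left this hK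
      linarith)) ht
  rw [gronwallBound_of_K_ne_0 (by linarith)] at h1
  refine h1.trans ?_
  have h2 : 2 * (K * absMass x₀ ^ 2) / (2 * -c) * (Real.exp (2 * -c * t) - 1) =
      K / c * absMass x₀ ^ 2 - K / c * absMass x₀ ^ 2 * Real.exp (2 * -c * t) := by
    field_simp
    ring
  have h3 : 0 ≤ K / c * absMass x₀ ^ 2 * Real.exp (2 * -c * t) := by positivity
  simp only
  rw [h2, show -(2 * c) * t = 2 * -c * t by ring]
  linarith

/-- Uniform exponential decay of the evolution on functions of mean zero. -/
theorem exists_decay (hα₁ : 0 < α₁) (hα : 0 < α) (hc : 0 < c) (hK : 0 ≤ K)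
    (hS : ∀ v, 0 ≤ v → 0 ≤ S v) {n : ℕ} (hn0 : 0 < n) {δ : ℝ} (hδ : 0 < δ)
    (hn : ∀ v, 0 ≤ v →
      (δ * inner ℝ v (Lp.const 2 m (1 : ℝ))) • Lp.const 2 m (1 : ℝ) ≤ (S ^ n) v) :
    ∃ C, 0 < C ∧ ∃ γ, 0 < γ ∧ ∀ {B : ℝ → Lp ℝ 2 m →L[ℝ] Lp ℝ 2 m} {x₀ : Lp ℝ 2 m}
      {x : ℝ → Lp ℝ 2 m}, IsDoeblinFamily S M α₁ α c K B → IsLinearEvolution B x₀ x →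
      inner ℝ x₀ (Lp.const 2 m (1 : ℝ)) = 0 → ∀ t, 0 ≤ t →
      ‖x t‖ ≤ C * Real.exp (-γ * t) * ‖x₀‖ := by
  have hg := unitGain_pos hα₁ hα
  -- The maximum with `0` makes `θ` nonnegative, so that `θ ^ 2 ≤ θ` when the contraction is
  -- squared.
  obtain ⟨θ, hθ0, hθ1, hθ⟩ : ∃ θ : ℝ, 0 ≤ θ ∧ θ < 1 ∧ 1 - unitGain α₁ α ^ n * δ ≤ θ :=
    ⟨max 0 (1 - unitGain α₁ α ^ n * δ), le_max_left _ _,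
      max_lt zero_lt_one (by have : 0 < unitGain α₁ α ^ n * δ := by positivity
                             linarith), le_max_right _ _⟩
  have hT : (0 : ℝ) < n := by exact_mod_cast hn0
  -- With this weight `K / c + L * θ = L * (1 + θ) / 2`: the `L¹` term created by the `L²` estimate
  -- uses half of the gain in the `L¹` contraction.
  set L : ℝ := 2 * (K / c) / (1 - θ) with hL
  have h1θ : 0 < 1 - θ := by linarith
  have hL0 : 0 ≤ L := by positivity
  have hLK : L * (1 - θ) = 2 * (K / c) := by rw [hL]; field_simp
  have hLK' : K / c ≤ L := by
    have : 0 ≤ L * θ := by positivity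
    have : 0 ≤ K / c := by positivity
    nlinarith
  set ρ : ℝ := max (Real.exp (-(2 * c) * n)) ((1 + θ) / 2) with hρ
  have hρ0 : 0 < ρ := lt_max_of_lt_left (Real.exp_pos _)
  have hρ1 : ρ < 1 := max_lt (by rw [Real.exp_lt_one_iff]; nlinarith) (by linarith)
  have hstep : ∀ {B : ℝ → Lp ℝ 2 m →L[ℝ] Lp ℝ 2 m} {x₀ : Lp ℝ 2 m} {x : ℝ → Lp ℝ 2 m},
      IsDoeblinFamily S M α₁ α c K B → IsLinearEvolution B x₀ x →
      inner ℝ x₀ (Lp.const 2 m (1 : ℝ)) = 0 →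
      ‖x n‖ ^ 2 + L * absMass (x n) ^ 2 ≤ ρ * (‖x₀‖ ^ 2 + L * absMass x₀ ^ 2) := by
    intro B x₀ x hB hx h0
    have e1 := hB.norm_sq_le hα₁.le hc hK hS hx hT.le
    have e2 : absMass (x n) ≤ θ * absMass x₀ :=
      (hB.absMass_le_of_mass_eq_zero hα₁ hα hS hn hx h0).trans
        (mul_le_mul_of_nonneg_right hθ (absMass_nonneg _))
    have e3 : absMass (x n) ^ 2 ≤ θ * absMass x₀ ^ 2 := by
      refine (pow_le_pow_left₀ (absMass_nonneg _) e2 2).trans ?_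
      rw [mul_pow]
      exact mul_le_mul_of_nonneg_right (by nlinarith) (sq_nonneg _)
    have e4 := mul_le_mul_of_nonneg_left e3 hL0
    have e5 : Real.exp (-(2 * c) * n) * ‖x₀‖ ^ 2 ≤ ρ * ‖x₀‖ ^ 2 :=
      mul_le_mul_of_nonneg_right (le_max_left _ _) (sq_nonneg _)
    have e6 : (1 + θ) / 2 * (L * absMass x₀ ^ 2) ≤ ρ * (L * absMass x₀ ^ 2) :=
      mul_le_mul_of_nonneg_right (le_max_right _ _) (by positivity)
    have e7 : K / c * absMass x₀ ^ 2 + L * (θ * absMass x₀ ^ 2) =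
        (1 + θ) / 2 * (L * absMass x₀ ^ 2) := by
      have : K / c = L * (1 - θ) / 2 := by linarith
      rw [this]; ring
    linarith
  have hiter : ∀ k : ℕ, ∀ {B : ℝ → Lp ℝ 2 m →L[ℝ] Lp ℝ 2 m} {x₀ : Lp ℝ 2 m}
      {x : ℝ → Lp ℝ 2 m}, IsDoeblinFamily S M α₁ α c K B → IsLinearEvolution B x₀ x →
      inner ℝ x₀ (Lp.const 2 m (1 : ℝ)) = 0 →
      ‖x (k * n)‖ ^ 2 + L * absMass (x (k * n)) ^ 2 ≤
        ρ ^ k * (‖x₀‖ ^ 2 + L * absMass x₀ ^ 2) := by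
    intro k
    induction k with
    | zero => intro B x₀ x hB hx h0; simp [hx.apply_zero]
    | succ k ih =>
      intro B x₀ x hB hx h0
      have e1 := ih (hB.shift n) (hx.shift hT.le) (by rw [hB.mass_eq hx hT.le, h0])
      have e2 := mul_le_mul_of_nonneg_left (hstep hB hx h0) (pow_nonneg hρ0.le k)
      rw [← mul_assoc, ← pow_succ] at e2
      have e3 : ((k + 1 : ℕ) : ℝ) * n = k * n + n := by push_cast; ring
      rw [e3]
      exact e1.trans e2
  -- The factor `1 + L` compares the functional with `‖x₀‖ ^ 2`, `1 / ρ` pays for the incomplete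
  -- last period, and the `2` in the rate comes from taking square roots.
  refine ⟨Real.sqrt ((1 + L) / ρ), by positivity, -Real.log ρ / (2 * n),
    div_pos (neg_pos.2 (Real.log_neg hρ0 hρ1)) (by positivity), ?_⟩
  intro B x₀ x hB hx h0 t ht
  set k := ⌊t / n⌋₊ with hk
  have hk1 : k * n ≤ t := by
    have := Nat.floor_le (div_nonneg ht hT.le)
    rwa [← hk, le_div_iff₀ hT] at this
  have hk2 : t / n < k + 1 := Nat.lt_floor_add_one _
  have hkn : (0 : ℝ) ≤ k * n := by positivity
  have e1 := (hB.shift (k * n)).norm_sq_le hα₁.le hc hK hS (hx.shift hkn)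
    (sub_nonneg.2 hk1)
  simp only [sub_add_cancel] at e1
  have e2 := hiter k hB hx h0
  have e3 : Real.exp (-(2 * c) * (t - k * n)) * ‖x (k * n)‖ ^ 2 ≤ ‖x (k * n)‖ ^ 2 := by
    refine mul_le_of_le_one_left (sq_nonneg _) ?_
    rw [Real.exp_le_one_iff]
    nlinarith [sub_nonneg.2 hk1]
  have e4 := mul_le_mul_of_nonneg_right hLK' (sq_nonneg (absMass (x (k * n))))
  have e5 : ‖x₀‖ ^ 2 + L * absMass x₀ ^ 2 ≤ (1 + L) * ‖x₀‖ ^ 2 := by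
    have := mul_le_mul_of_nonneg_left
      (pow_le_pow_left₀ (absMass_nonneg x₀) (absMass_le_norm x₀) 2) hL0
    linarith
  have e6 : ρ ^ k ≤ ρ⁻¹ * Real.exp (-(-Real.log ρ / (2 * n)) * t) ^ 2 := by
    have : ρ⁻¹ * Real.exp (-(-Real.log ρ / (2 * n)) * t) ^ 2 = ρ ^ (t / n - 1) := by
      have : ((2 : ℕ) : ℝ) * (-(-Real.log ρ / (2 * n)) * t) = Real.log ρ * (t / n) := by
        push_cast
        field_simp
      rw [Real.rpow_sub_one hρ0.ne', Real.rpow_def_of_pos hρ0, ← Real.exp_nat_mul,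
        this, div_eq_inv_mul (Real.exp _)]
    rw [this, ← Real.rpow_natCast]
    exact Real.rpow_le_rpow_of_exponent_ge hρ0 hρ1.le (by linarith)
  have e7 : ‖x t‖ ^ 2 ≤
      (Real.sqrt ((1 + L) / ρ) * Real.exp (-(-Real.log ρ / (2 * n)) * t) * ‖x₀‖) ^ 2 := by
    rw [mul_pow, mul_pow, Real.sq_sqrt (by positivity)]
    calc ‖x t‖ ^ 2 ≤ ρ ^ k * ((1 + L) * ‖x₀‖ ^ 2) := by
          have := mul_le_mul_of_nonneg_left e5 (pow_nonneg hρ0.le k)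
          linarith
      _ ≤ ρ⁻¹ * Real.exp (-(-Real.log ρ / (2 * n)) * t) ^ 2 * ((1 + L) * ‖x₀‖ ^ 2) :=
          mul_le_mul_of_nonneg_right e6 (by positivity)
      _ = _ := by ring
  exact (sq_le_sq₀ (norm_nonneg _) (by positivity)).1 e7

end IsDoeblinFamily

/-! ### Convolution powers on compact groups -/

section ConvolutionPowers

open Filter Topology Measure
open scoped ENNReal Pointwise

/-- The convolution powers of a measure. -/
noncomputable def convPow {G : Type*} [AddMonoid G] [MeasurableSpace G] (ν : Measure G) :
    ℕ → Measure G
  | 0 => dirac 0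
  | n + 1 => convPow ν n ∗ ν

theorem smul_conv_smul {G : Type*} [AddMonoid G] [MeasurableSpace G] {μ ν : Measure G} [SFinite μ] [SFinite ν] (C D : ℝ≥0∞) :
    (C • μ) ∗ (D • ν) = (C * D) • (μ ∗ ν) := by
  rw [conv_smul_left, conv_smul_right, smul_smul]

theorem le_smul_of_smul_le {G : Type*} [MeasurableSpace G] {μ κ : Measure G} {c C : ℝ≥0∞} (hc : c ≠ 0) (hc' : c ≠ ∞)
    (h : c • μ ≤ C • κ) : μ ≤ (c⁻¹ * C) • κ := by
  intro s
  have := h s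
  simp only [Measure.smul_apply, smul_eq_mul] at this ⊢
  rw [mul_assoc, ← ENNReal.div_eq_inv_mul, ENNReal.le_div_iff_mul_le (Or.inl hc) (Or.inl hc'),
    mul_comm]
  exact this

variable {G : Type*} [AddCommGroup G] [TopologicalSpace G] [IsTopologicalAddGroup G]
  [MeasurableSpace G] [BorelSpace G] [SecondCountableTopology G] {ρ ν : Measure G}

instance [IsProbabilityMeasure ν] (n : ℕ) : IsProbabilityMeasure (convPow ν n) := by
  induction n with
  | zero => exact dirac.isProbabilityMeasure
  | succ n ih => unfold convPow; infer_instance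

theorem convPow_add [IsProbabilityMeasure ν] (n k : ℕ) :
    convPow ν (n + k) = convPow ν n ∗ convPow ν k := by
  induction k with
  | zero => simp [convPow]
  | succ k ih => rw [← add_assoc, convPow, ih, convPow, conv_assoc]

theorem convPow_two [IsProbabilityMeasure ν] : convPow ν 2 = ν ∗ ν := by
  simp [convPow]

theorem conv_mono {μ μ' ν ν' : Measure G} [SFinite ν'] (h1 : μ ≤ μ') (h2 : ν ≤ ν') :
    μ ∗ ν ≤ μ' ∗ ν' :=
  Measure.map_mono (prod_mono h1 h2) measurable_add

/-- By Fubini and invariance, `ρ.restrict E ∗ ρ.restrict F` has density `x ↦ ρ (E ∩ (x - F))` with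
respect to `ρ`. -/
theorem smul_restrict_le_conv [ρ.IsAddLeftInvariant] [SFinite ρ] {E F W : Set G}
    (hE : MeasurableSet E) (hF : MeasurableSet F) (hW : MeasurableSet W) {c : ℝ≥0∞}
    (h : ∀ x ∈ W, c ≤ ρ (E ∩ {w | x - w ∈ F})) :
    c • ρ.restrict W ≤ ρ.restrict E ∗ ρ.restrict F := by
  refine Measure.le_iff.2 fun s hs => ?_
  have h1 : (ρ.restrict E ∗ ρ.restrict F) s =
      ∫⁻ w, ∫⁻ x, E.indicator 1 w * (F.indicator 1 (x - w) * s.indicator 1 x) ∂ρ ∂ρ := by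
    rw [← lintegral_indicator_one hs, lintegral_conv (measurable_one.indicator hs),
      ← lintegral_indicator hE]
    refine lintegral_congr fun w => ?_
    by_cases hw : w ∈ E
    · rw [indicator_of_mem hw, indicator_of_mem hw, ← lintegral_indicator hF]
      simp only [Pi.one_apply, one_mul]
      rw [← lintegral_add_left_eq_self
        (fun x => F.indicator 1 (x - w) * s.indicator (1 : G → ℝ≥0∞) x) w]
      refine lintegral_congr fun z => ?_
      rw [add_sub_cancel_left]
      by_cases hz : z ∈ F <;> simp [hz]
    · simp [hw]
  have hm : Measurable fun p : G × G =>
      E.indicator (1 : G → ℝ≥0∞) p.1 * (F.indicator 1 (p.2 - p.1) * s.indicator 1 p.2) :=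
    ((measurable_one.indicator hE).comp measurable_fst).mul
      (((measurable_one.indicator hF).comp (measurable_snd.sub measurable_fst)).mul
        ((measurable_one.indicator hs).comp measurable_snd))
  rw [h1, lintegral_lintegral_swap hm.aemeasurable, Measure.smul_apply, smul_eq_mul,
    restrict_apply hs, ← lintegral_indicator_one (hs.inter hW), ← lintegral_const_mul _
      (measurable_one.indicator (hs.inter hW))]
  refine lintegral_mono fun x => ?_
  by_cases hx : x ∈ s ∩ W
  · rw [indicator_of_mem hx, Pi.one_apply, mul_one]
    refine (h x hx.2).trans ?_
    have hmE : MeasurableSet (E ∩ {w | x - w ∈ F}) :=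
      hE.inter ((measurable_const.sub measurable_id) hF)
    rw [← lintegral_indicator_one hmE]
    refine lintegral_mono fun w => ?_
    classical
    simp only [indicator_apply, mem_inter_iff, mem_ofPred_eq, Pi.one_apply, hx.1, if_true, mul_one]
    split_ifs <;> simp_all
  · rw [indicator_of_notMem hx]
    simp

/-- `ν` dominates a multiple of `ρ` near `x`. -/
def DominatesNear (ρ ν : Measure G) (x : G) : Prop :=
  ∃ C : ℝ≥0∞, C ≠ ∞ ∧ ∃ U : Set G, IsOpen U ∧ x ∈ U ∧ ρ.restrict U ≤ C • ν

/-- For `z` near `x + y` the set `U ∩ (z - V)` contains the translate `x + N` of a fixed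
neighbourhood of `0`, so the density of the convolution is at least `ρ N` there. -/
theorem DominatesNear.conv [ρ.IsAddHaarMeasure] [IsFiniteMeasure ρ] {μ ν : Measure G} [SFinite μ]
    [SFinite ν] {x y : G} (hμ : DominatesNear ρ μ x) (hν : DominatesNear ρ ν y) :
    DominatesNear ρ (μ ∗ ν) (x + y) := by
  obtain ⟨C, hC, U, hU, hxU, h1⟩ := hμ
  obtain ⟨D, hD, V, hV, hyV, h2⟩ := hν
  have hc : Continuous fun p : G × G => (x + p.1, y + p.2 - p.1) := by fun_prop
  have hpre : (fun p : G × G => (x + p.1, y + p.2 - p.1)) ⁻¹' (U ×ˢ V) ∈ 𝓝 ((0 : G), (0 : G)) :=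
    hc.continuousAt.preimage_mem_nhds ((hU.prod hV).mem_nhds (by simp [hxU, hyV]))
  rw [nhds_prod_eq, mem_prod_iff] at hpre
  obtain ⟨N₁, hN₁, N₂, hN₂, hsub⟩ := hpre
  obtain ⟨N, hN, hNo, hN0⟩ := mem_nhds_iff.1 (inter_mem hN₁ hN₂)
  have hpos : ρ N ≠ 0 := (hNo.measure_pos ρ ⟨0, hN0⟩).ne'
  have hWo : IsOpen {z : G | z - (x + y) ∈ N} := hNo.preimage (by fun_prop)
  have h3 : ρ N • ρ.restrict {z : G | z - (x + y) ∈ N} ≤ ρ.restrict U ∗ ρ.restrict V := by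
    refine smul_restrict_le_conv hU.measurableSet hV.measurableSet hWo.measurableSet
      fun z hz => ?_
    have h4 : ρ N = ρ ((fun w => -x + w) ⁻¹' N) := (measure_preimage_add ρ (-x) N).symm
    rw [h4]
    refine measure_mono fun w hw => ?_
    have hw' : -x + w ∈ N := hw
    have := hsub (mk_mem_prod (hN hw').1 (hN hz).2)
    simp only [mem_preimage, mem_prod] at this
    refine ⟨?_, ?_⟩
    · have := this.1
      rwa [add_neg_cancel_left] at this
    · have := this.2
      rwa [show y + (z - (x + y)) - (-x + w) = z - w by abel] at this
  have h5 := h3.trans (conv_mono h1 h2)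
  rw [smul_conv_smul] at h5
  exact ⟨_, ENNReal.mul_ne_top (ENNReal.inv_ne_top.2 hpos) (ENNReal.mul_ne_top hC hD), _, hWo,
    by simpa using hN0, le_smul_of_smul_le hpos (measure_ne_top _ _) h5⟩

/-- The square of an absolutely continuous measure dominates the Haar measure on some open set. -/
theorem exists_dominatesNear_conv [T2Space G] [CompactSpace G] [ρ.IsAddHaarMeasure]
    [IsFiniteMeasure ρ] [IsProbabilityMeasure ν] (hν : ν ≪ ρ) :
    ∃ x, DominatesNear ρ (ν ∗ ν) x := by
  have hreg : ρ.InnerRegularCompactLTTop := inferInstance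
  -- The density of `ν` is not almost everywhere zero, so it is bounded below on a set `E` of
  -- positive measure.
  obtain ⟨E, hE, hE0, C, hC, hEC⟩ : ∃ E, MeasurableSet E ∧ ρ E ≠ 0 ∧ ∃ C : ℝ≥0∞, C ≠ ∞ ∧
      ρ.restrict E ≤ C • ν := by
    have hf := measurable_rnDeriv ν ρ
    have hwd : ρ.withDensity (ν.rnDeriv ρ) = ν := withDensity_rnDeriv_eq ν ρ hν
    have hne : ρ {x | 0 < ν.rnDeriv ρ x} ≠ 0 := by
      intro h0
      have h1 : ν.rnDeriv ρ =ᵐ[ρ] 0 := by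
        rw [Filter.EventuallyEq, ae_iff]
        simpa [pos_iff_ne_zero] using h0
      have h2 : ν univ = 0 := by
        rw [← hwd, withDensity_apply _ MeasurableSet.univ, restrict_univ, lintegral_congr_ae h1]
        simp
      simp at h2
    have hU : {x | 0 < ν.rnDeriv ρ x} = ⋃ n : ℕ, {x | ((n : ℝ≥0∞) + 1)⁻¹ ≤ ν.rnDeriv ρ x} := by
      ext x
      simp only [mem_ofPred_eq, mem_iUnion]
      constructor
      · intro hx
        obtain ⟨n, hn⟩ := ENNReal.exists_inv_nat_lt hx.ne'
        exact ⟨n, (ENNReal.inv_le_inv.2 le_self_add).trans hn.le⟩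
      · rintro ⟨n, hn⟩
        exact lt_of_lt_of_le (ENNReal.inv_pos.2 (by finiteness)) hn
    rw [hU] at hne
    obtain ⟨n, hn⟩ : ∃ n : ℕ, ρ {x | ((n : ℝ≥0∞) + 1)⁻¹ ≤ ν.rnDeriv ρ x} ≠ 0 := by
      by_contra! hcon
      exact hne (measure_iUnion_null hcon)
    have hmeas : MeasurableSet {x | ((n : ℝ≥0∞) + 1)⁻¹ ≤ ν.rnDeriv ρ x} :=
      measurableSet_le measurable_const hf
    refine ⟨_, hmeas, hn, (n : ℝ≥0∞) + 1, by finiteness, ?_⟩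
    have hle : (((n : ℝ≥0∞) + 1)⁻¹) • ρ.restrict {x | ((n : ℝ≥0∞) + 1)⁻¹ ≤ ν.rnDeriv ρ x} ≤
        (1 : ℝ≥0∞) • ν := by
      rw [one_smul]
      refine Measure.le_iff.2 fun s hs => ?_
      rw [Measure.smul_apply, smul_eq_mul, restrict_apply hs]
      calc _ = ∫⁻ _ in s ∩ {x | ((n : ℝ≥0∞) + 1)⁻¹ ≤ ν.rnDeriv ρ x}, ((n : ℝ≥0∞) + 1)⁻¹ ∂ρ := by
            rw [setLIntegral_const]
        _ ≤ ∫⁻ x in s ∩ {x | ((n : ℝ≥0∞) + 1)⁻¹ ≤ ν.rnDeriv ρ x}, ν.rnDeriv ρ x ∂ρ :=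
            setLIntegral_mono hf fun x hx => hx.2
        _ ≤ ∫⁻ x in s, ν.rnDeriv ρ x ∂ρ := lintegral_mono_set inter_subset_left
        _ = ν s := by rw [← withDensity_apply _ hs, hwd]
    have := le_smul_of_smul_le (ENNReal.inv_ne_zero.2 (by finiteness))
      (ENNReal.inv_ne_top.2 (by simp)) hle
    rwa [inv_inv, mul_one] at this
  -- The integral of `ρ (E ∩ (x - E))` over `x` is `ρ E ^ 2`, which is positive.
  have hpos : ∃ x₀, ρ (E ∩ {w | x₀ - w ∈ E}) ≠ 0 := by
    by_contra! hcon
    have h1 : ∫⁻ x, ∫⁻ w, E.indicator 1 w * E.indicator 1 (x - w) ∂ρ ∂ρ = 0 := by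
      rw [← lintegral_zero (μ := ρ)]
      refine lintegral_congr fun x => ?_
      have hmE : MeasurableSet (E ∩ {w | x - w ∈ E}) :=
        hE.inter ((measurable_const.sub measurable_id) hE)
      rw [← hcon x, ← lintegral_indicator_one hmE]
      refine lintegral_congr fun w => ?_
      classical
    simp only [indicator_apply, mem_inter_iff, mem_ofPred_eq, Pi.one_apply]
      split_ifs <;> simp_all
    have hm : Measurable fun p : G × G =>
        E.indicator (1 : G → ℝ≥0∞) p.2 * E.indicator 1 (p.1 - p.2) :=
      ((measurable_one.indicator hE).comp measurable_snd).mul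
        ((measurable_one.indicator hE).comp (measurable_fst.sub measurable_snd))
    rw [lintegral_lintegral_swap hm.aemeasurable] at h1
    have h2 : ∀ w, ∫⁻ x, E.indicator (1 : G → ℝ≥0∞) w * E.indicator 1 (x - w) ∂ρ =
        E.indicator 1 w * ρ E := fun w => by
      rw [lintegral_const_mul _ (f := fun x => E.indicator (1 : G → ℝ≥0∞) (x - w))
          ((measurable_one.indicator hE).comp (measurable_id.sub_const w)),
        lintegral_sub_right_eq_self (fun x => E.indicator (1 : G → ℝ≥0∞) x),
        lintegral_indicator_one hE]
    simp_rw [h2] at h1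
    rw [lintegral_mul_const _ (measurable_one.indicator hE), lintegral_indicator_one hE] at h1
    exact hE0 (mul_self_eq_zero.1 h1)
  obtain ⟨x₀, hx₀⟩ := hpos
  have hmE : MeasurableSet (E ∩ {w | x₀ - w ∈ E}) :=
    hE.inter ((measurable_const.sub measurable_id) hE)
  obtain ⟨k, hkE, hk, hk0⟩ := hmE.exists_lt_isCompact_of_ne_top (measure_ne_top ρ _)
    (pos_iff_ne_zero.2 hx₀)
  have hhalf : ρ k / 2 ≠ 0 := by simp [hk0.ne']
  -- Steinhaus' argument: for `z` near `x₀`, `E ∩ (z - E)` contains `((z - x₀) + k) ∩ k`, which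
  -- keeps at least half of the measure of `k`.
  have ht := tendsto_measure_vadd_sdiff_isCompact_isClosed (μ := ρ) hk hk.isClosed
  have hev : ∀ᶠ g in 𝓝 (0 : G), ρ ((g +ᵥ k) \ k) < ρ k / 2 :=
    ht.eventually_lt_const (pos_iff_ne_zero.2 hhalf)
  obtain ⟨N, hN, hNo, hN0⟩ := mem_nhds_iff.1 hev
  have hWo : IsOpen {z : G | z - x₀ ∈ N} := hNo.preimage (by fun_prop)
  have h3 : (ρ k / 2) • ρ.restrict {z : G | z - x₀ ∈ N} ≤ ρ.restrict E ∗ ρ.restrict E := by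
    refine smul_restrict_le_conv hE hE hWo.measurableSet fun z hz => ?_
    have h4 : ρ ((z - x₀) +ᵥ k) ≤ ρ (((z - x₀) +ᵥ k) ∩ k) + ρ (((z - x₀) +ᵥ k) \ k) :=
      (measure_inter_add_sdiff _ hk.measurableSet).symm.le
    rw [measure_vadd] at h4
    have h5 : ρ k / 2 ≤ ρ (((z - x₀) +ᵥ k) ∩ k) := by
      by_contra! hlt
      have h6 := ENNReal.add_lt_add hlt (hN hz)
      rw [ENNReal.add_halves] at h6
      exact absurd h4 (not_le.2 h6)
    refine h5.trans (measure_mono ?_)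
    rintro w ⟨⟨v, hv, rfl⟩, hw⟩
    refine ⟨(hkE hw).1, ?_⟩
    have := (hkE hv).2
    simp only [mem_ofPred_eq, vadd_eq_add] at this ⊢
    rwa [show z - (z - x₀ + v) = x₀ - v by abel]
  have h5 := h3.trans (conv_mono hEC hEC)
  rw [smul_conv_smul] at h5
  exact ⟨x₀, _, ENNReal.mul_ne_top (ENNReal.inv_ne_top.2 hhalf) (ENNReal.mul_ne_top hC hC), _, hWo,
    by simpa using hN0, le_smul_of_smul_le hhalf
      (ENNReal.div_ne_top (measure_ne_top _ _) (by simp)) h5⟩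

theorem DominatesNear.convPow_nsmul [ρ.IsAddHaarMeasure] [IsFiniteMeasure ρ]
    [IsProbabilityMeasure ν] {x : G} {n : ℕ} (h : DominatesNear ρ (convPow ν n) x) (k : ℕ) :
    DominatesNear ρ (convPow ν ((k + 1) * n)) ((k + 1) • x) := by
  induction k with
  | zero => simpa using h
  | succ k ih =>
    rw [add_mul _ 1, one_mul, convPow_add, add_smul _ 1, one_smul]
    exact ih.conv h

/-- On a compact group all of whose elements are multiples of small elements, some convolution power
of an absolutely continuous measure dominates the Haar measure. -/
theorem exists_le_smul_convPow [T2Space G] [CompactSpace G] [ρ.IsAddHaarMeasure]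
    [IsFiniteMeasure ρ] [IsProbabilityMeasure ν] (hν : ν ≪ ρ)
    (hG : ∀ N ∈ 𝓝 (0 : G), ∃ k : ℕ, ∀ z : G, ∃ y ∈ N, (k + 1) • y = z) :
    ∃ n, 0 < n ∧ ∃ C : ℝ≥0∞, C ≠ ∞ ∧ ρ ≤ C • convPow ν n := by
  obtain ⟨x₀, C₀, hC₀, U₀, hU₀, hx₀, h₀⟩ := exists_dominatesNear_conv hν
  have hN : (fun y => x₀ + y) ⁻¹' U₀ ∈ 𝓝 (0 : G) :=
    (continuous_const_add x₀).continuousAt.preimage_mem_nhds (hU₀.mem_nhds (by simpa using hx₀))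
  obtain ⟨k, hk⟩ := hG _ hN
  -- Write `z = (k + 1) • (x₀ + y)` with `y` small. The number of convolution factors is the same
  -- for all `z`, so a finite subcover gives a single power dominating `ρ`.
  have hall : ∀ z : G, DominatesNear ρ (convPow ν ((k + 1) * 2)) z := by
    intro z
    obtain ⟨y, hy, hyz⟩ := hk (z - (k + 1) • x₀)
    have h1 : DominatesNear ρ (convPow ν 2) (x₀ + y) := by
      rw [convPow_two]
      exact ⟨C₀, hC₀, U₀, hU₀, hy, h₀⟩
    have h2 := h1.convPow_nsmul k
    rwa [smul_add, hyz, add_sub_cancel] at h2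
  choose C hC U hU hzU hle using hall
  obtain ⟨t, ht⟩ := isCompact_univ.elim_finite_subcover U hU
    fun z _ => mem_iUnion.2 ⟨z, hzU z⟩
  refine ⟨(k + 1) * 2, by positivity, ∑ z ∈ t, C z, ENNReal.sum_ne_top.2 fun z _ => hC z, ?_⟩
  refine Measure.le_iff.2 fun s hs => ?_
  calc ρ s ≤ ρ (⋃ z ∈ t, s ∩ U z) := measure_mono fun w hw => by
        have := ht (mem_univ w)
        simp only [mem_iUnion] at this ⊢
        obtain ⟨z, hz, hwz⟩ := this
        exact ⟨z, hz, hw, hwz⟩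
    _ ≤ ∑ z ∈ t, ρ (s ∩ U z) := measure_biUnion_finset_le _ _
    _ ≤ ∑ z ∈ t, C z * convPow ν ((k + 1) * 2) s := Finset.sum_le_sum fun z _ => by
        rw [← restrict_apply hs]
        exact hle z s
    _ = _ := by rw [Measure.smul_apply, smul_eq_mul, Finset.sum_mul]

end ConvolutionPowers

/-! ### Small roots on the torus and the projection of Lebesgue measure -/

section Torus

open Filter Topology

/-- Lift `z` to `[0, 1)^d` and divide by `k + 1`. -/
theorem torus_exists_nsmul_eq {d : ℕ} (N : Set (UnitAddTorus (Fin d))) (hN : N ∈ 𝓝 0) :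
    ∃ k : ℕ, ∀ z : UnitAddTorus (Fin d), ∃ y ∈ N, (k + 1) • y = z := by
  set π : (Fin d → ℝ) → UnitAddTorus (Fin d) := fun r i => (r i : UnitAddCircle) with hπ
  have hc : Continuous π := continuous_pi fun i =>
    (AddCircle.continuous_mk' (1 : ℝ)).comp (continuous_apply i)
  have hN' : π ⁻¹' N ∈ 𝓝 0 := hc.continuousAt.preimage_mem_nhds (by
    have : π 0 = 0 := by ext i; simp [hπ]
    rwa [this])
  obtain ⟨ε, hε, hball⟩ := Metric.mem_nhds_iff.1 hN'
  obtain ⟨k, hk⟩ := exists_nat_one_div_lt hε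
  refine ⟨k, fun z => ?_⟩
  have hrep : ∀ i, ∃ r : ℝ, 0 ≤ r ∧ r < 1 ∧ (r : UnitAddCircle) = z i := fun i => by
    obtain ⟨r, hr⟩ := QuotientAddGroup.mk_surjective (z i)
    refine ⟨Int.fract r, Int.fract_nonneg r, Int.fract_lt_one r, ?_⟩
    rw [← hr, Int.fract]
    change ((r - ⌊r⌋ : ℝ) : UnitAddCircle) = (r : UnitAddCircle)
    rw [AddCircle.coe_sub, sub_eq_self, AddCircle.coe_eq_zero_iff]
    exact ⟨⌊r⌋, by simp⟩
  choose r h0 h1 hr using hrep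
  refine ⟨π fun i => r i / (k + 1), hball ?_, ?_⟩
  · rw [mem_ball_zero_iff]
    refine lt_of_le_of_lt ((pi_norm_le_iff_of_nonneg (by positivity)).2 fun i => ?_) hk
    rw [Real.norm_eq_abs, abs_of_nonneg (div_nonneg (h0 i) (by positivity))]
    exact div_le_div_of_nonneg_right (h1 i).le (by positivity)
  · funext i
    rw [Pi.smul_apply, hπ, ← hr i]
    simp only
    rw [← AddCircle.coe_nsmul]
    congr 1
    rw [nsmul_eq_mul]
    push_cast
    field_simp

/-- Space is the countable union of half open unit cells, on each of which the projection preserves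
measure. -/
theorem map_torusProj_absolutelyContinuous {d : ℕ} :
    (volume : Measure (EuclideanSpace ℝ (Fin d))).map torusProj ≪ volume := by
  refine Measure.AbsolutelyContinuous.mk fun s hs h0 => ?_
  rw [Measure.map_apply measurable_torusProj hs]
  have hms : MeasurableSet {x : Fin d → ℝ | (fun i => (x i : UnitAddCircle)) ∈ s} :=
    (measurable_pi_lambda _ fun i =>
      (AddCircle.measurable_mk' (a := (1 : ℝ))).comp (measurable_pi_apply i)) hs
  have h1 : ∀ b : Fin d → ℤ, volume {x : Fin d → ℝ | (∀ i, x i ∈ Ioc (b i : ℝ) (b i + 1)) ∧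
      (fun i => (x i : UnitAddCircle)) ∈ s} = 0 := by
    intro b
    have h := (measurePreserving_pi _ _
      fun i => UnitAddCircle.measurePreserving_mk (b i : ℝ)).measure_preimage hs.nullMeasurableSet
    rw [← Measure.restrict_pi_pi (fun _ => volume) fun i => Ioc (b i : ℝ) (b i + 1),
      Measure.restrict_apply (t := (fun (x : Fin d → ℝ) i => (x i : UnitAddCircle)) ⁻¹' s) hms] at h
    refine (measure_mono fun x hx => ?_).trans_eq (h.trans h0) |>.antisymm bot_le
    exact ⟨hx.2, fun i _ => hx.1 i⟩
  have h2 : volume {x : Fin d → ℝ | (fun i => (x i : UnitAddCircle)) ∈ s} = 0 := by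
    refine measure_mono_null ?_ (measure_iUnion_null h1)
    intro x hx
    -- The cells are open on the left and closed on the right, hence the ceiling minus one.
    refine mem_iUnion.2 ⟨fun i => ⌈x i⌉ - 1, fun i => ⟨?_, ?_⟩, hx⟩
    · push_cast
      linarith [Int.ceil_lt_add_one (x i)]
    · push_cast
      linarith [Int.le_ceil (x i)]
  exact (PiLp.volume_preserving_ofLp (Fin d)).quasiMeasurePreserving.preimage_null h2

end Torus

/-! ### Correlations and jump measures on the torus -/

/-! ### Weak measurability in separable Hilbert spaces -/

section WeakMeasurability

/-- Inner products with a dense sequence embed `H` continuously and injectively into a countable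
product of lines; by the Lusin–Souslin theorem this is a measurable embedding. -/
theorem stronglyMeasurable_of_measurable_inner {H α : Type*} [NormedAddCommGroup H]
    [InnerProductSpace ℝ H] [CompleteSpace H] [SecondCountableTopology H] [MeasurableSpace α]
    {f : α → H} (hf : ∀ g, Measurable fun t => inner ℝ (f t) g) : StronglyMeasurable f := by
  borelize H
  have hΦ : Continuous fun (x : H) (n : ℕ) => inner ℝ x (TopologicalSpace.denseSeq H n) :=
    continuous_pi fun n => continuous_id.inner continuous_const
  have hinj : Function.Injective
      fun (x : H) (n : ℕ) => inner ℝ x (TopologicalSpace.denseSeq H n) := by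
    intro x y hxy
    have h1 : (fun v => inner ℝ x v) = fun v : H => inner ℝ y v :=
      (TopologicalSpace.denseRange_denseSeq H).equalizer (continuous_const.inner continuous_id)
        (continuous_const.inner continuous_id) hxy
    exact ext_inner_right ℝ fun v => congrFun h1 v
  have he := hΦ.measurableEmbedding hinj
  exact (he.measurable_comp_iff.1 (measurable_pi_lambda _ fun n => hf _)).stronglyMeasurable

end WeakMeasurability

/-- Truncate the density: `f ≤ n + (f - n)⁺`, and the integral of the excess tends to zero. The
truncation level is `K`. -/
theorem exists_integral_le_of_absolutelyContinuous {X : Type*} [MeasurableSpace X] [Nonempty X]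
    {ρ ν : Measure X} [IsFiniteMeasure ρ] [IsFiniteMeasure ν] (hν : ν ≪ ρ) {ε : ℝ} (hε : 0 < ε) :
    ∃ K : ℝ, 0 ≤ K ∧ ∀ (φ : X → ℝ) (R : ℝ), StronglyMeasurable φ → (∀ x, 0 ≤ φ x) →
      (∀ x, φ x ≤ R) → ∫ x, φ x ∂ν ≤ K * ∫ x, φ x ∂ρ + ε * R := by
  set f : X → ℝ := fun x => (ν.rnDeriv ρ x).toReal with hf
  have hfi : Integrable f ρ := Measure.integrable_toReal_rnDeriv
  have hf0 : ∀ x, 0 ≤ f x := fun x => ENNReal.toReal_nonneg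
  have ht : Filter.Tendsto (fun n : ℕ => ∫ x, max (f x - n) 0 ∂ρ) Filter.atTop
      (nhds (∫ _, (0 : ℝ) ∂ρ)) := by
    refine tendsto_integral_of_dominated_convergence f (fun n => ?_) hfi (fun n => ?_) ?_
    · exact ((hfi.1.sub aestronglyMeasurable_const).sup aestronglyMeasurable_const)
    · refine Filter.Eventually.of_forall fun x => ?_
      rw [Real.norm_eq_abs, abs_of_nonneg (le_max_right _ _)]
      exact max_le (by linarith [(n.cast_nonneg : (0 : ℝ) ≤ n)]) (hf0 x)
    · refine Filter.Eventually.of_forall fun x => ?_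
      obtain ⟨N, hN⟩ := exists_nat_ge (f x)
      refine tendsto_const_nhds.congr' ?_
      filter_upwards [Filter.eventually_ge_atTop N] with n hn
      rw [max_eq_right]
      have : (N : ℝ) ≤ n := by exact_mod_cast hn
      linarith
  rw [integral_zero] at ht
  obtain ⟨n, hn⟩ := (ht.eventually_lt_const hε).exists
  refine ⟨n, n.cast_nonneg, fun φ R hφ h0 hR => ?_⟩
  obtain ⟨x₀⟩ := ‹Nonempty X›
  have hR0 : 0 ≤ R := (h0 x₀).trans (hR x₀)
  have hφi : Integrable φ ρ := Integrable.of_bound hφ.aestronglyMeasurable R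
    (Filter.Eventually.of_forall fun x => by
      rw [Real.norm_eq_abs, abs_of_nonneg (h0 x)]; exact hR x)
  have hmi : Integrable (fun x => max (f x - n) 0) ρ :=
    (hfi.sub (integrable_const _)).sup (integrable_zero _ _ _)
  have h1 : ∫ x, φ x ∂ν = ∫ x, f x * φ x ∂ρ := (integral_rnDeriv_smul hν).symm
  have h2 : ∫ x, f x * φ x ∂ρ ≤ ∫ x, (n * φ x + R * max (f x - n) 0) ∂ρ := by
    refine integral_mono (hfi.mul_bdd (c := R) hφ.aestronglyMeasurable
      (Filter.Eventually.of_forall fun x => by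
        rw [Real.norm_eq_abs, abs_of_nonneg (h0 x)]; exact hR x))
      ((hφi.const_mul _).add (hmi.const_mul _)) fun x => ?_
    have e1 : f x - n ≤ max (f x - n) 0 := le_max_left _ _
    have e2 : 0 ≤ max (f x - n) 0 := le_max_right _ _
    have e3 := mul_le_mul_of_nonneg_right e1 (h0 x)
    have e4 := mul_le_mul_of_nonneg_left (hR x) e2
    simp only
    nlinarith
  rw [h1]
  refine h2.trans ?_
  rw [integral_add (hφi.const_mul _) (hmi.const_mul _), integral_const_mul, integral_const_mul]
  have := mul_le_mul_of_nonneg_left hn.le hR0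
  linarith

/-! ### Translations and correlations -/

section Correlation

variable {d : ℕ}

instance : IsProbabilityMeasure (volume : Measure UnitAddCircle) :=
  ⟨UnitAddCircle.measure_univ⟩

instance : IsProbabilityMeasure (volume : Measure (UnitAddTorus (Fin d))) :=
  inferInstanceAs (IsProbabilityMeasure (Measure.pi fun _ => volume))

instance : (volume : Measure (UnitAddTorus (Fin d))).IsAddHaarMeasure :=
  inferInstanceAs (Measure.IsAddHaarMeasure (Measure.pi fun _ => volume))

instance : (volume : Measure (UnitAddTorus (Fin d))).IsNegInvariant :=
  Measure.IsAddHaarMeasure.isNegInvariant_of_innerRegular volume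

theorem measurePreserving_sub_snd (ν : Measure (UnitAddTorus (Fin d))) [IsProbabilityMeasure ν] :
    MeasurePreserving (fun p : UnitAddTorus (Fin d) × UnitAddTorus (Fin d) => p.1 - p.2)
      (volume.prod ν) volume := by
  have h1 := (MeasurePreserving.id ν).skew_product (μc := (volume : Measure (UnitAddTorus (Fin d))))
    (μd := (volume : Measure (UnitAddTorus (Fin d)))) (g := fun z ξ => ξ - z)
    (measurable_snd.sub measurable_fst)
    (Filter.Eventually.of_forall fun z =>
      (measurePreserving_sub_right (volume : Measure (UnitAddTorus (Fin d))) z).map_eq)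
  exact (measurePreserving_snd.comp h1).comp Measure.measurePreserving_swap

/-- The torusTranslate `ξ ↦ v(ξ + y)`. -/
noncomputable def torusTranslate (y : UnitAddTorus (Fin d)) (v : TorusL2 d) : TorusL2 d :=
  Lp.compMeasurePreserving (fun ξ => ξ + y) (measurePreserving_add_right volume y) v

theorem norm_translate (y : UnitAddTorus (Fin d)) (v : TorusL2 d) : ‖torusTranslate y v‖ = ‖v‖ :=
  Lp.norm_compMeasurePreserving _ _

theorem coeFn_translate (y : UnitAddTorus (Fin d)) (v : TorusL2 d) :
    ⇑(torusTranslate y v) =ᵐ[volume] fun ξ => v (ξ + y) :=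
  Lp.coeFn_compMeasurePreserving _ _

theorem translate_nonneg (y : UnitAddTorus (Fin d)) {v : TorusL2 d} (hv : 0 ≤ v) :
    0 ≤ torusTranslate y v := by
  rw [← Lp.coeFn_nonneg] at hv ⊢
  filter_upwards [coeFn_translate y v, (measurePreserving_add_right
    (volume : Measure (UnitAddTorus (Fin d))) y).quasiMeasurePreserving.ae hv] with ξ h1 h2
  rw [h1]
  exact h2

/-- The correlation `y ↦ ∫ v(ξ) g(ξ + y) dξ`. -/
noncomputable def corr (v g : TorusL2 d) (y : UnitAddTorus (Fin d)) : ℝ :=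
  inner ℝ v (torusTranslate y g)

theorem corr_eq_integral (v g : TorusL2 d) (y : UnitAddTorus (Fin d)) :
    corr v g y = ∫ ξ, v (ξ - y) * g ξ := by
  rw [corr, Lp_inner_eq_integral,
    ← integral_sub_right_eq_self (fun ξ => v ξ * (torusTranslate y g) ξ) y]
  refine integral_congr_ae ?_
  filter_upwards [(measurePreserving_sub_right
    (volume : Measure (UnitAddTorus (Fin d))) y).quasiMeasurePreserving.ae (coeFn_translate y g)]
    with ξ h
  rw [h, sub_add_cancel]

theorem stronglyMeasurable_corr (v g : TorusL2 d) : StronglyMeasurable (corr v g) := by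
  have h : corr v g = fun y => ∫ ξ, v (ξ - y) * g ξ := funext (corr_eq_integral v g)
  rw [h]
  have hm : Measurable fun p : UnitAddTorus (Fin d) × UnitAddTorus (Fin d) =>
      v (p.2 - p.1) * g p.2 :=
    ((Lp.stronglyMeasurable v).measurable.comp (measurable_snd.sub measurable_fst)).mul
      ((Lp.stronglyMeasurable g).measurable.comp measurable_snd)
  exact hm.stronglyMeasurable.integral_prod_right

theorem abs_corr_le (v g : TorusL2 d) (y : UnitAddTorus (Fin d)) : |corr v g y| ≤ ‖v‖ * ‖g‖ := by
  have := abs_real_inner_le_norm v (torusTranslate y g)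
  rwa [norm_translate] at this

theorem corr_nonneg {v g : TorusL2 d} (hv : 0 ≤ v) (hg : 0 ≤ g) (y : UnitAddTorus (Fin d)) :
    0 ≤ corr v g y :=
  Lp_inner_nonneg hv (translate_nonneg y hg)

theorem integrable_corr (v g : TorusL2 d) (ν : Measure (UnitAddTorus (Fin d)))
    [IsFiniteMeasure ν] : Integrable (corr v g) ν :=
  Integrable.of_bound (stronglyMeasurable_corr v g).aestronglyMeasurable (‖v‖ * ‖g‖)
    (Filter.Eventually.of_forall (abs_corr_le v g))

theorem corr_translate (v g : TorusL2 d) (y z : UnitAddTorus (Fin d)) :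
    corr v (torusTranslate y g) z = corr v g (y + z) := by
  rw [corr, corr]
  congr 1
  refine Lp.ext ?_
  filter_upwards [coeFn_translate z (torusTranslate y g), coeFn_translate (y + z) g,
    (measurePreserving_add_right (volume : Measure (UnitAddTorus (Fin d)))
      z).quasiMeasurePreserving.ae (coeFn_translate y g)] with ξ h1 h2 h3
  rw [h1, h2, h3]
  congr 1
  abel

/-- Averaging over all translations decouples the two factors. For `|v|` with itself the value is
`absMass v ^ 2`. -/
theorem integral_corr_volume (v g : TorusL2 d) :
    ∫ y, corr v g y = (∫ ξ, v ξ) * ∫ ξ, g ξ := by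
  have hi : Integrable (fun p : UnitAddTorus (Fin d) × UnitAddTorus (Fin d) =>
      v (p.1 - p.2) * g p.1) (volume.prod volume) :=
    ((Lp.memLp v).comp_measurePreserving (measurePreserving_sub_snd volume)).integrable_mul
      ((Lp.memLp g).comp_measurePreserving measurePreserving_fst)
  simp_rw [corr_eq_integral]
  rw [← integral_prod_symm _ hi, integral_prod _ hi, ← integral_const_mul]
  refine integral_congr_ae (Filter.Eventually.of_forall fun ξ => ?_)
  simp only
  rw [integral_mul_const, integral_sub_left_eq_self (fun y => v y) volume ξ]

variable {ν : Measure (UnitAddTorus (Fin d))} [IsProbabilityMeasure ν]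

theorem integrable_shear (v g : TorusL2 d) :
    Integrable (fun p : UnitAddTorus (Fin d) × UnitAddTorus (Fin d) => v (p.1 - p.2) * g p.1)
      (volume.prod ν) :=
  ((Lp.memLp v).comp_measurePreserving (measurePreserving_sub_snd ν)).integrable_mul
    ((Lp.memLp g).comp_measurePreserving measurePreserving_fst)

theorem integrable_fst (v g : TorusL2 d) :
    Integrable (fun p : UnitAddTorus (Fin d) × UnitAddTorus (Fin d) => v p.1 * g p.1)
      (volume.prod ν) :=
  ((Lp.memLp v).comp_measurePreserving measurePreserving_fst).integrable_mul
    ((Lp.memLp g).comp_measurePreserving measurePreserving_fst)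

theorem integral_shear (v g : TorusL2 d) :
    ∫ p : UnitAddTorus (Fin d) × UnitAddTorus (Fin d), v (p.1 - p.2) * g p.1 ∂(volume.prod ν) =
      ∫ y, corr v g y ∂ν := by
  simp_rw [corr_eq_integral]
  exact integral_prod_symm _ (integrable_shear v g)

theorem integral_fst (v g : TorusL2 d) :
    ∫ p : UnitAddTorus (Fin d) × UnitAddTorus (Fin d), v p.1 * g p.1 ∂(volume.prod ν) =
      inner ℝ v g := by
  rw [Lp_inner_eq_integral, integral_fun_fst (fun ξ => v ξ * g ξ)]
  simp

theorem integral_corr_le (v g : TorusL2 d) : ∫ y, corr v g y ∂ν ≤ ‖v‖ * ‖g‖ := by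
  have := integral_mono (integrable_corr v g ν) (integrable_const (‖v‖ * ‖g‖))
    fun y => (le_abs_self _).trans (abs_corr_le v g y)
  simpa using this

end Correlation

/-! ### The nonlocal operator -/

section Nonlocal

variable {d : ℕ}

/-- The distribution of a jump on the torus. -/
noncomputable def jumpMeasure (a : EuclideanSpace ℝ (Fin d) → ℝ) :
    Measure (UnitAddTorus (Fin d)) :=
  (volume.withDensity fun z => ENNReal.ofReal (a z)).map torusProj

variable {a : EuclideanSpace ℝ (Fin d) → ℝ}

theorem IsJumpKernel.isProbabilityMeasure (ha : IsJumpKernel a) :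
    IsProbabilityMeasure (jumpMeasure a) := by
  have : IsProbabilityMeasure
      ((volume : Measure (EuclideanSpace ℝ (Fin d))).withDensity fun z => ENNReal.ofReal (a z)) := by
    refine ⟨?_⟩
    rw [withDensity_apply _ MeasurableSet.univ, Measure.restrict_univ,
      ← ofReal_integral_eq_lintegral_ofReal ha.integrable
        (Filter.Eventually.of_forall ha.nonneg), ha.integral_eq_one, ENNReal.ofReal_one]
  exact Measure.isProbabilityMeasure_map measurable_torusProj.aemeasurable

theorem jumpMeasure_absolutelyContinuous : jumpMeasure a ≪ volume :=
  ((withDensity_absolutelyContinuous _ _).map measurable_torusProj).trans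
    map_torusProj_absolutelyContinuous

variable {m : UnitAddTorus (Fin d) → UnitAddTorus (Fin d) → ℝ}

theorem nonlocalIntegral_eq (ha : IsJumpKernel a)
    (hm : Measurable fun q : UnitAddTorus (Fin d) × UnitAddTorus (Fin d) => m q.1 q.2)
    {v : UnitAddTorus (Fin d) → ℝ} (hv : Measurable v) (ξ : UnitAddTorus (Fin d)) :
    nonlocalIntegral a m v ξ = ∫ y, m ξ (ξ - y) * (v (ξ - y) - v ξ) ∂(jumpMeasure a) := by
  have hs : Measurable fun y : UnitAddTorus (Fin d) => ξ - y := measurable_const.sub measurable_id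
  have hf : Measurable fun y => m ξ (ξ - y) * (v (ξ - y) - v ξ) :=
    (hm.comp (measurable_const.prodMk hs)).mul ((hv.comp hs).sub_const _)
  rw [jumpMeasure, integral_map measurable_torusProj.aemeasurable
    hf.stronglyMeasurable.aestronglyMeasurable, integral_withDensity_eq_integral_toReal_smul₀
      ha.integrable.1.aemeasurable.ennreal_ofReal (by simp)]
  refine integral_congr_ae (Filter.Eventually.of_forall fun z => ?_)
  simp only [ENNReal.toReal_ofReal (ha.nonneg z), smul_eq_mul]
  ring

/-- The integrand of the bilinear form of the nonlocal operator. -/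
noncomputable def formIntegrand (m : UnitAddTorus (Fin d) → UnitAddTorus (Fin d) → ℝ) (v g : TorusL2 d)
    (p : UnitAddTorus (Fin d) × UnitAddTorus (Fin d)) : ℝ :=
  m p.1 (p.1 - p.2) * (v (p.1 - p.2) * g p.1 - v p.1 * g p.1)

theorem measurable_shear_coefficient
    (hm : Measurable fun q : UnitAddTorus (Fin d) × UnitAddTorus (Fin d) => m q.1 q.2) :
    Measurable fun p : UnitAddTorus (Fin d) × UnitAddTorus (Fin d) => m p.1 (p.1 - p.2) :=
  hm.comp (measurable_fst.prodMk (measurable_fst.sub measurable_snd))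

theorem integrable_formIntegrand (ha : IsJumpKernel a)
    (hm : Measurable fun q : UnitAddTorus (Fin d) × UnitAddTorus (Fin d) => m q.1 q.2)
    {R : ℝ} (hR : ∀ x y, |m x y| ≤ R) (v g : TorusL2 d) :
    Integrable (formIntegrand m v g) (volume.prod (jumpMeasure a)) := by
  have := ha.isProbabilityMeasure
  exact ((integrable_shear v g).sub (integrable_fst v g)).bdd_mul (c := R)
    (measurable_shear_coefficient hm).aestronglyMeasurable
    (Filter.Eventually.of_forall fun p => hR _ _)

/-- Reduces the operator estimates to pointwise comparisons of integrands on the product of the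
torus with the jump measure. -/
theorem inner_nonlocal (ha : IsJumpKernel a)
    (hm : Measurable fun q : UnitAddTorus (Fin d) × UnitAddTorus (Fin d) => m q.1 q.2)
    {R : ℝ} (hR : ∀ x y, |m x y| ≤ R) (v g : TorusL2 d) :
    inner ℝ (nonlocalOperator a m v) g =
      ∫ p, formIntegrand m v g p ∂(volume.prod (jumpMeasure a)) := by
  have := ha.isProbabilityMeasure
  rw [Lp_inner_eq_integral, integral_prod _ (integrable_formIntegrand ha hm hR v g)]
  refine integral_congr_ae ?_
  filter_upwards [isNonlocalOperator_nonlocalOperator ha hm hR v] with ξ h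
  rw [h, nonlocalIntegral_eq ha hm (Lp.stronglyMeasurable v).measurable, ← integral_mul_const]
  refine integral_congr_ae (Filter.Eventually.of_forall fun y => ?_)
  simp only [formIntegrand]
  ring

/-- The transition operator `v ↦ ∫ v(· - z) a(z) dz`. -/
noncomputable def transition (a : EuclideanSpace ℝ (Fin d) → ℝ) : TorusL2 d →L[ℝ] TorusL2 d :=
  nonlocalOperator a (fun _ _ => 1) + ContinuousLinearMap.id ℝ _

theorem inner_transition (ha : IsJumpKernel a) (v g : TorusL2 d) :
    inner ℝ (transition a v) g = ∫ y, corr v g y ∂(jumpMeasure a) := by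
  have := ha.isProbabilityMeasure
  rw [transition, add_apply, inner_add_left,
    inner_nonlocal ha measurable_const (R := 1) (by simp)]
  simp only [formIntegrand, one_mul]
  rw [integral_sub (integrable_shear v g) (integrable_fst v g), integral_shear, integral_fst]
  simp

theorem coeFn_abs_shear (ν : Measure (UnitAddTorus (Fin d))) [IsProbabilityMeasure ν]
    (v : TorusL2 d) : ∀ᵐ p ∂(volume.prod ν), |v| (p.1 - p.2) = |v (p.1 - p.2)| :=
  (measurePreserving_sub_snd ν).quasiMeasurePreserving.ae (Lp.coeFn_abs v)

theorem coeFn_abs_fst (ν : Measure (UnitAddTorus (Fin d))) [IsProbabilityMeasure ν]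
    (v : TorusL2 d) : ∀ᵐ p ∂(volume.prod ν), |v| p.1 = |v p.1| :=
  (measurePreserving_fst (μ := volume) (ν := ν)).quasiMeasurePreserving.ae (Lp.coeFn_abs v)

theorem coeFn_nonneg_shear (ν : Measure (UnitAddTorus (Fin d))) [IsProbabilityMeasure ν]
    {v : TorusL2 d} (hv : 0 ≤ v) : ∀ᵐ p ∂(volume.prod ν), 0 ≤ v (p.1 - p.2) :=
  (measurePreserving_sub_snd ν).quasiMeasurePreserving.ae ((Lp.coeFn_nonneg v).2 hv)

theorem coeFn_nonneg_fst (ν : Measure (UnitAddTorus (Fin d))) [IsProbabilityMeasure ν]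
    {v : TorusL2 d} (hv : 0 ≤ v) : ∀ᵐ p ∂(volume.prod ν), 0 ≤ v p.1 :=
  (measurePreserving_fst (μ := volume) (ν := ν)).quasiMeasurePreserving.ae
    ((Lp.coeFn_nonneg v).2 hv)

theorem norm_nonlocalOperator_le (ha : IsJumpKernel a)
    (hm : Measurable fun q : UnitAddTorus (Fin d) × UnitAddTorus (Fin d) => m q.1 q.2)
    {R : ℝ} (hR : ∀ x y, |m x y| ≤ R) : ‖nonlocalOperator a m‖ ≤ 2 * R := by
  have := ha.isProbabilityMeasure
  have hR0 : 0 ≤ R := (abs_nonneg _).trans (hR 0 0)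
  refine ContinuousLinearMap.opNorm_le_bound _ (by positivity) fun v => ?_
  set g := nonlocalOperator a m v with hg
  have h1 : inner ℝ g g ≤ ∫ p : UnitAddTorus (Fin d) × UnitAddTorus (Fin d),
      (R * (|v| (p.1 - p.2) * |g| p.1) + R * (|v| p.1 * |g| p.1))
        ∂(volume.prod (jumpMeasure a)) := by
    conv_lhs => rw [hg]
    rw [← hg, inner_nonlocal ha hm hR]
    refine integral_mono_ae (integrable_formIntegrand ha hm hR v g)
      (((integrable_shear _ _).const_mul _).add ((integrable_fst _ _).const_mul _)) ?_
    filter_upwards [coeFn_abs_shear (jumpMeasure a) v, coeFn_abs_fst (jumpMeasure a) v,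
      coeFn_abs_fst (jumpMeasure a) g] with p e1 e2 e3
    rw [e1, e2, e3, formIntegrand, ← mul_add, ← abs_mul, ← abs_mul]
    refine (le_abs_self _).trans ?_
    rw [abs_mul]
    exact mul_le_mul (hR _ _) (abs_sub _ _) (abs_nonneg _) hR0
  rw [integral_add ((integrable_shear _ _).const_mul _) ((integrable_fst _ _).const_mul _),
    integral_const_mul, integral_const_mul, integral_shear, integral_fst,
    real_inner_self_eq_norm_sq] at h1
  have h2 := mul_le_mul_of_nonneg_left (integral_corr_le (ν := jumpMeasure a) |v| |g|) hR0
  have h3 := mul_le_mul_of_nonneg_left (real_inner_le_norm |v| |g|) hR0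
  rw [norm_abs_eq_norm, norm_abs_eq_norm] at h2 h3
  rcases (norm_nonneg g).eq_or_lt with h0 | h0
  · rw [← h0]
    positivity
  · nlinarith

theorem nonlocalOperator_const_one (ha : IsJumpKernel a)
    (hm : Measurable fun q : UnitAddTorus (Fin d) × UnitAddTorus (Fin d) => m q.1 q.2)
    {R : ℝ} (hR : ∀ x y, |m x y| ≤ R) :
    nonlocalOperator a m (Lp.const 2 volume (1 : ℝ)) = 0 := by
  have := ha.isProbabilityMeasure
  refine ext_inner_right ℝ fun g => ?_
  rw [inner_zero_left, inner_nonlocal ha hm hR]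
  refine integral_eq_zero_of_ae ?_
  have h := Lp.coeFn_const (p := 2) (μ := (volume : Measure (UnitAddTorus (Fin d)))) (1 : ℝ)
  filter_upwards [(measurePreserving_sub_snd (jumpMeasure a)).quasiMeasurePreserving.ae h,
    (measurePreserving_fst (μ := volume) (ν := jumpMeasure a)).quasiMeasurePreserving.ae h]
    with p h1 h2
  rw [formIntegrand, h1, h2]
  simp

/-- The gain term has coefficient at least `α₁`, and the loss term, with coefficient at most `α₂`,
is absorbed by `α₂ ⟨v, g⟩`. -/
theorem le_inner_nonlocal_add (ha : IsJumpKernel a)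
    (hm : Measurable fun q : UnitAddTorus (Fin d) × UnitAddTorus (Fin d) => m q.1 q.2)
    {α₁ α₂ : ℝ} (hα₁ : 0 ≤ α₁) (h₁ : ∀ x y, α₁ ≤ m x y) (h₂ : ∀ x y, m x y ≤ α₂)
    {v g : TorusL2 d} (hv : 0 ≤ v) (hg : 0 ≤ g) :
    α₁ * inner ℝ (transition a v) g ≤
      inner ℝ (nonlocalOperator a m v) g + α₂ * inner ℝ v g := by
  have := ha.isProbabilityMeasure
  have hR : ∀ x y, |m x y| ≤ α₂ := fun x y => by
    rw [abs_of_nonneg (hα₁.trans (h₁ x y))]; exact h₂ x y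
  have hi := integrable_formIntegrand ha hm hR v g
  have hf : Integrable (fun p : UnitAddTorus (Fin d) × UnitAddTorus (Fin d) =>
      α₂ * (v p.1 * g p.1)) (volume.prod (jumpMeasure a)) := (integrable_fst v g).const_mul _
  rw [inner_transition ha, inner_nonlocal ha hm hR, ← integral_shear v g,
    ← integral_fst (ν := jumpMeasure a) v g, ← integral_const_mul, ← integral_const_mul,
    ← integral_add hi hf]
  refine integral_mono_ae ((integrable_shear v g).const_mul _) (hi.add hf) ?_
  filter_upwards [coeFn_nonneg_shear (jumpMeasure a) hv, coeFn_nonneg_fst (jumpMeasure a) hv,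
    coeFn_nonneg_fst (jumpMeasure a) hg] with p e1 e2 e3
  have f1 := mul_le_mul_of_nonneg_right (h₁ p.1 (p.1 - p.2)) (mul_nonneg e1 e3)
  have f2 := mul_le_mul_of_nonneg_right (h₂ p.1 (p.1 - p.2)) (mul_nonneg e2 e3)
  simp only [formIntegrand]
  linarith

theorem inner_nonlocal_self_le (ha : IsJumpKernel a)
    (hm : Measurable fun q : UnitAddTorus (Fin d) × UnitAddTorus (Fin d) => m q.1 q.2)
    {α₁ α₂ : ℝ} (hα₁ : 0 ≤ α₁) (h₁ : ∀ x y, α₁ ≤ m x y) (h₂ : ∀ x y, m x y ≤ α₂)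
    (v : TorusL2 d) :
    inner ℝ (nonlocalOperator a m v) v ≤
      α₂ * ∫ y, corr |v| |v| y ∂(jumpMeasure a) - α₁ * ‖v‖ ^ 2 := by
  have := ha.isProbabilityMeasure
  have hR : ∀ x y, |m x y| ≤ α₂ := fun x y => by
    rw [abs_of_nonneg (hα₁.trans (h₁ x y))]; exact h₂ x y
  have i1 : Integrable (fun p : UnitAddTorus (Fin d) × UnitAddTorus (Fin d) =>
      α₂ * (|v| (p.1 - p.2) * |v| p.1)) (volume.prod (jumpMeasure a)) :=
    (integrable_shear |v| |v|).const_mul _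
  have i2 : Integrable (fun p : UnitAddTorus (Fin d) × UnitAddTorus (Fin d) =>
      α₁ * (v p.1 * v p.1)) (volume.prod (jumpMeasure a)) := (integrable_fst v v).const_mul _
  rw [inner_nonlocal ha hm hR, ← integral_shear |v| |v|, ← real_inner_self_eq_norm_sq,
    ← integral_fst (ν := jumpMeasure a) v v, ← integral_const_mul, ← integral_const_mul,
    ← integral_sub i1 i2]
  refine integral_mono_ae (integrable_formIntegrand ha hm hR v v) (i1.sub i2) ?_
  filter_upwards [coeFn_abs_shear (jumpMeasure a) v, coeFn_abs_fst (jumpMeasure a) v]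
    with p e1 e2
  have f1 := mul_le_mul_of_nonneg_right (h₁ p.1 (p.1 - p.2)) (mul_self_nonneg (v p.1))
  have f2 : m p.1 (p.1 - p.2) * (v (p.1 - p.2) * v p.1) ≤ α₂ * |v (p.1 - p.2) * v p.1| := by
    refine (le_abs_self _).trans ?_
    rw [abs_mul]
    exact mul_le_mul_of_nonneg_right (hR _ _) (abs_nonneg _)
  rw [abs_mul] at f2
  simp only [formIntegrand, e1, e2]
  linarith

/-- In `inner_nonlocal_self_le` the positive term is a correlation integrated against an absolutely
continuous measure. Truncating with `ε = α₁ / (2 α₂)` costs half of the dissipation and leaves a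
multiple of `absMass v ^ 2`. -/
theorem exists_inner_nonlocal_self_le (ha : IsJumpKernel a) {α₁ α₂ : ℝ} (hα₁ : 0 < α₁)
    (hα : α₁ ≤ α₂) :
    ∃ K, 0 ≤ K ∧ ∀ {m : UnitAddTorus (Fin d) → UnitAddTorus (Fin d) → ℝ},
      (Measurable fun q : UnitAddTorus (Fin d) × UnitAddTorus (Fin d) => m q.1 q.2) →
      (∀ x y, α₁ ≤ m x y) → (∀ x y, m x y ≤ α₂) → ∀ v : TorusL2 d,
      inner ℝ (nonlocalOperator a m v) v ≤ -(α₁ / 2) * ‖v‖ ^ 2 + K * absMass v ^ 2 := by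
  have := ha.isProbabilityMeasure
  have hα₂ : 0 < α₂ := hα₁.trans_le hα
  obtain ⟨K, hK, h⟩ := exists_integral_le_of_absolutelyContinuous
    (jumpMeasure_absolutelyContinuous (a := a)) (show 0 < α₁ / (2 * α₂) by positivity)
  refine ⟨α₂ * K, by positivity, fun {m} hm h₁ h₂ v => ?_⟩
  refine (inner_nonlocal_self_le ha hm hα₁.le h₁ h₂ v).trans ?_
  have h3 := h (corr |v| |v|) (‖v‖ ^ 2) (stronglyMeasurable_corr _ _)
    (corr_nonneg (abs_nonneg v) (abs_nonneg v)) fun y => by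
      have := (le_abs_self _).trans (abs_corr_le |v| |v| y)
      rwa [norm_abs_eq_norm, ← pow_two] at this
  rw [integral_corr_volume, ← Lp_inner_const_one] at h3
  have h4 := mul_le_mul_of_nonneg_left h3 hα₂.le
  have h5 : α₂ * (α₁ / (2 * α₂) * ‖v‖ ^ 2) = α₁ / 2 * ‖v‖ ^ 2 := by field_simp
  rw [mul_add, h5] at h4
  rw [absMass]
  nlinarith

theorem corr_transition (ha : IsJumpKernel a) (v g : TorusL2 d) (y : UnitAddTorus (Fin d)) :
    corr (transition a v) g y = ∫ z, corr v g (y + z) ∂(jumpMeasure a) := by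
  rw [corr, inner_transition ha]
  simp_rw [corr_translate]

/-- Powers of the operator correspond to convolution powers of the jump measure, so domination of
measures becomes domination of operators. -/
theorem inner_transition_pow (ha : IsJumpKernel a) (n : ℕ) (v g : TorusL2 d) :
    inner ℝ ((transition a ^ n) v) g = ∫ y, corr v g y ∂(convPow (jumpMeasure a) n) := by
  have := ha.isProbabilityMeasure
  induction n generalizing v with
  | zero =>
    rw [convPow, integral_dirac, corr_eq_integral, pow_zero, Lp_inner_eq_integral]
    simp
  | succ n ih =>
    rw [pow_succ, mul_apply_eq_comp, ih, convPow, Measure.conv,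
      integral_map measurable_add.aemeasurable
        (stronglyMeasurable_corr v g).aestronglyMeasurable, integral_prod]
    · exact integral_congr_ae (Filter.Eventually.of_forall fun y => corr_transition ha v g y)
    · exact (integrable_corr v g (convPow (jumpMeasure a) n ∗ jumpMeasure a)).comp_measurable
        measurable_add

theorem transition_nonneg (ha : IsJumpKernel a) {v : TorusL2 d} (hv : 0 ≤ v) :
    0 ≤ transition a v :=
  Lp_nonneg_of_inner fun g hg => by
    rw [inner_transition ha]; exact integral_nonneg (corr_nonneg hv hg)

theorem adjoint_transition_nonneg (ha : IsJumpKernel a) (v : TorusL2 d) (hv : 0 ≤ v) :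
    0 ≤ ContinuousLinearMap.adjoint (transition a) v :=
  Lp_nonneg_of_inner fun g hg => by
    rw [ContinuousLinearMap.adjoint_inner_left]
    exact Lp_inner_nonneg hv (transition_nonneg ha hg)

theorem exists_smul_const_le_adjoint_transition_pow (ha : IsJumpKernel a) :
    ∃ n, 0 < n ∧ ∃ δ : ℝ, 0 < δ ∧ ∀ v : TorusL2 d, 0 ≤ v →
      (δ * inner ℝ v (Lp.const 2 volume (1 : ℝ))) • Lp.const 2 volume (1 : ℝ) ≤
        (ContinuousLinearMap.adjoint (transition a) ^ n) v := by
  have := ha.isProbabilityMeasure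
  obtain ⟨n, hn, C, hC, hle⟩ := exists_le_smul_convPow
    (jumpMeasure_absolutelyContinuous (a := a)) torus_exists_nsmul_eq
  -- Adding `1` makes the reciprocal positive without a lower bound on `C`.
  refine ⟨n, hn, (C.toReal + 1)⁻¹, by positivity, fun v hv => Lp_le_of_inner fun g hg => ?_⟩
  have hadj : ContinuousLinearMap.adjoint (transition a) ^ n =
      ContinuousLinearMap.adjoint (transition a ^ n) := by
    simp only [← ContinuousLinearMap.star_eq_adjoint, star_pow]
  rw [hadj, ContinuousLinearMap.adjoint_inner_left, real_inner_comm ((transition a ^ n) g) v, inner_transition_pow ha,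
    real_inner_smul_left, real_inner_comm g, Lp_inner_const_one, Lp_inner_const_one]
  have hfin : IsFiniteMeasure (C • convPow (jumpMeasure a) n) := Measure.smul_finite _ hC
  have h1 := integral_mono_measure hle
    (Filter.Eventually.of_forall (corr_nonneg hg hv)) (integrable_corr g v _)
  rw [integral_corr_volume, integral_smul_measure, smul_eq_mul] at h1
  have h2 : 0 ≤ ∫ y, corr g v y ∂(convPow (jumpMeasure a) n) := integral_nonneg (corr_nonneg hg hv)
  rw [mul_assoc, inv_mul_le_iff₀ (by positivity)]
  nlinarith

instance : SecondCountableTopology (TorusL2 d) := by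
  have : Fact ((2 : ENNReal) ≠ ⊤) := ⟨by norm_num⟩
  infer_instance

/-- The adjoints of the nonlocal operators, run backwards in time, form a Doeblin family. -/
theorem isDoeblinFamily_adjoint_nonlocalOperator (ha : IsJumpKernel a) {α₁ α₂ K : ℝ}
    (hα₁ : 0 < α₁)
    (hK : ∀ {m : UnitAddTorus (Fin d) → UnitAddTorus (Fin d) → ℝ},
      (Measurable fun q : UnitAddTorus (Fin d) × UnitAddTorus (Fin d) => m q.1 q.2) →
      (∀ x y, α₁ ≤ m x y) → (∀ x y, m x y ≤ α₂) → ∀ v : TorusL2 d,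
      inner ℝ (nonlocalOperator a m v) v ≤ -(α₁ / 2) * ‖v‖ ^ 2 + K * absMass v ^ 2)
    {κ : UnitAddTorus (Fin d) → UnitAddTorus (Fin d) → ℝ → ℝ}
    (hκ : Measurable fun q : UnitAddTorus (Fin d) × UnitAddTorus (Fin d) × ℝ =>
      κ q.1 q.2.1 q.2.2)
    (h₁ : ∀ x y t, α₁ ≤ κ x y t) (h₂ : ∀ x y t, κ x y t ≤ α₂) :
    IsBoundedFamily (fun t => nonlocalOperator a fun x y => κ x y t) (2 * α₂) ∧
    IsDoeblinFamily (ContinuousLinearMap.adjoint (transition a)) (2 * α₂) α₁ α₂ (α₁ / 2) K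
      fun t => ContinuousLinearMap.adjoint (nonlocalOperator a fun x y => κ x y t) := by
  have := ha.isProbabilityMeasure
  have hm : ∀ t, Measurable fun q : UnitAddTorus (Fin d) × UnitAddTorus (Fin d) =>
      κ q.1 q.2 t := fun t =>
    hκ.comp (measurable_fst.prodMk (measurable_snd.prodMk measurable_const))
  have hR : ∀ t x y, |κ x y t| ≤ α₂ := fun t x y => by
    rw [abs_of_nonneg (hα₁.le.trans (h₁ x y t))]; exact h₂ x y t
  have hmeas : ∀ v g : TorusL2 d, Measurable fun t =>
      inner ℝ (nonlocalOperator a (fun x y => κ x y t) v) g := fun v g => by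
    simp_rw [fun t => inner_nonlocal ha (hm t) (hR t) v g]
    have hv := (Lp.stronglyMeasurable v).measurable
    have hg := (Lp.stronglyMeasurable g).measurable
    have hF : Measurable fun q : ℝ × UnitAddTorus (Fin d) × UnitAddTorus (Fin d) =>
        formIntegrand (fun x y => κ x y q.1) v g q.2 := by
      have s1 : Measurable fun q : ℝ × UnitAddTorus (Fin d) × UnitAddTorus (Fin d) => q.2.1 :=
        measurable_fst.comp measurable_snd
      have s2 : Measurable fun q : ℝ × UnitAddTorus (Fin d) × UnitAddTorus (Fin d) =>
          q.2.1 - q.2.2 := s1.sub (measurable_snd.comp measurable_snd)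
      exact (hκ.comp (s1.prodMk (s2.prodMk measurable_fst))).mul
        (((hv.comp s2).mul (hg.comp s1)).sub ((hv.comp s1).mul (hg.comp s1)))
    exact hF.stronglyMeasurable.integral_prod_right'.measurable
  refine ⟨⟨fun v => stronglyMeasurable_of_measurable_inner (hmeas v),
    fun t => norm_nonlocalOperator_le ha (hm t) (hR t)⟩, ⟨⟨fun v => ?_, fun t => ?_⟩, ?_, ?_, ?_⟩⟩
  · refine stronglyMeasurable_of_measurable_inner fun g => ?_
    simp_rw [ContinuousLinearMap.adjoint_inner_left, real_inner_comm _ v]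
    exact hmeas g v
  · rw [LinearIsometryEquiv.norm_map]
    exact norm_nonlocalOperator_le ha (hm t) (hR t)
  · intro t v
    rw [ContinuousLinearMap.adjoint_inner_left, nonlocalOperator_const_one ha (hm t) (hR t),
      inner_zero_right]
  · intro t v hv
    refine Lp_le_of_inner fun g hg => ?_
    have := le_inner_nonlocal_add ha (hm t) hα₁.le (fun x y => h₁ x y t) (fun x y => h₂ x y t)
      hg hv
    rw [real_inner_smul_left, inner_add_left, real_inner_smul_left,
      ContinuousLinearMap.adjoint_inner_left, ContinuousLinearMap.adjoint_inner_left]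
    rwa [real_inner_comm, real_inner_comm v, real_inner_comm v] at this
  · intro t v
    rw [ContinuousLinearMap.adjoint_inner_left, real_inner_comm]
    exact hK (hm t) (fun x y => h₁ x y t) (fun x y => h₂ x y t) v

end Nonlocal

/-! ### Exponential convergence -/

/-- Time reversal `t ↦ N - t` turns the terminal value problem into an initial value problem. -/
theorem IsBackwardSolution.isLinearEvolution {d : ℕ} {A : ℝ → TorusL2 d →L[ℝ] TorusL2 d} {N : ℝ}
    {p : ℝ → TorusL2 d} (hp : IsBackwardSolution A N p) :
    IsLinearEvolution (fun t => ContinuousLinearMap.adjoint (A (N - t)))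
      (Lp.const 2 volume (1 : ℝ)) fun t => p (N - t) := by
  refine ⟨hp.1.comp (by fun_prop) fun t ht => sub_le_self N ht, fun t ht => ?_⟩
  obtain ⟨h1, h2⟩ := hp.2 (N - t) (sub_le_self N ht)
  refine ⟨?_, ?_⟩
  · have := (h1.comp_sub_left N).symm
    simpa using this
  · change p (N - t) = _ + ∫ r in (0 : ℝ)..t, ContinuousLinearMap.adjoint (A (N - r)) (p (N - r))
    rw [h2, intervalIntegral.integral_comp_sub_left
      (fun r => ContinuousLinearMap.adjoint (A r) (p r)), sub_zero]

/-- Exponential convergence of the solutions of the forward problem to the constant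
`C(N) = ∫ u₀ p^N(·,0)`, with constants that depend only on `d`, `a`, `α₁`, `α₂`. -/
theorem lemma3p4 {d : ℕ} (a : EuclideanSpace ℝ (Fin d) → ℝ) (ha : IsJumpKernel a)
    (α₁ α₂ : ℝ) (hα₁ : 0 < α₁) :
    ∃ C₄ : ℝ, 0 < C₄ ∧ ∃ γ₀ : ℝ, 0 < γ₀ ∧
      ∀ {Ω : Type*} [MeasurableSpace Ω] (P : MeasureTheory.Measure Ω)
        [MeasureTheory.IsProbabilityMeasure P]
        (μ : Ω → UnitAddTorus (Fin d) → UnitAddTorus (Fin d) → ℝ → ℝ),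
        IsRandomCoefficient P α₁ α₂ μ →
        ∀ (ω : Ω) (N : ℝ), 0 < N → ∀ (u₀ : TorusL2 d) (u p : ℝ → TorusL2 d),
          IsForwardSolution (fun t => nonlocalOperator a (fun x y => μ ω x y t)) u₀ u →
          IsBackwardSolution (fun t => nonlocalOperator a (fun x y => μ ω x y t)) N p →
          ∀ s : ℝ, 0 < s → s ≤ N →
            ‖u s - MeasureTheory.Lp.const 2 MeasureTheory.volume
                (∫ ξ : UnitAddTorus (Fin d), u₀ ξ * p 0 ξ)‖
              ≤ C₄ * Real.exp (-γ₀ * s) * ‖u₀‖ := by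
  -- For `α₂ < α₁` no coefficient satisfies both bounds, so any constants serve.
  rcases lt_or_ge α₂ α₁ with hlt | hα
  · refine ⟨1, one_pos, 1, one_pos, ?_⟩
    intro Ω _ P _ μ hμ ω
    exact absurd ((hμ.lower ω 0 0 0).trans (hμ.upper ω 0 0 0)) (not_le.2 hlt)
  have hα₂ : 0 < α₂ := hα₁.trans_le hα
  obtain ⟨K, hK, hdiss⟩ := exists_inner_nonlocal_self_le ha hα₁ hα
  obtain ⟨n, hn, δ, hδ, hlow⟩ := exists_smul_const_le_adjoint_transition_pow ha
  have hS := adjoint_transition_nonneg ha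
  have hc : 0 < α₁ / 2 := half_pos hα₁
  obtain ⟨C, hC, γ, hγ, hdecay⟩ := IsDoeblinFamily.exists_decay (M := 2 * α₂) hα₁ hα₂ hc hK hS hn
    hδ hlow
  have hq : 0 ≤ K / (α₁ / 2) := by positivity
  refine ⟨C * (2 + K / (α₁ / 2)), by positivity, γ, hγ, ?_⟩
  intro Ω _ P _ μ hμ ω N hN u₀ u p hu hp s hs hsN
  set A : ℝ → TorusL2 d →L[ℝ] TorusL2 d :=
    fun t => nonlocalOperator a (fun x y => μ ω x y t) with hA
  set e : TorusL2 d := Lp.const 2 volume (1 : ℝ) with he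
  have hee : inner ℝ e e = 1 := by
    rw [real_inner_self_eq_norm_sq, he, Lp_norm_const_one, one_pow]
  have hmeas : ∀ θ : ℝ → ℝ, Measurable θ → Measurable
      fun q : UnitAddTorus (Fin d) × UnitAddTorus (Fin d) × ℝ => μ ω q.1 q.2.1 (θ q.2.2) :=
    fun θ hθ => hμ.measurable.comp (measurable_const.prodMk (measurable_fst.prodMk
      ((measurable_fst.comp measurable_snd).prodMk
        (hθ.comp (measurable_snd.comp measurable_snd)))))
  have hAb := (isDoeblinFamily_adjoint_nonlocalOperator ha hα₁ hdiss (hmeas id measurable_id)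
    (fun x y t => hμ.lower ω x y t) fun x y t => hμ.upper ω x y t).1
  have hB : ∀ r, IsDoeblinFamily (ContinuousLinearMap.adjoint (transition a)) (2 * α₂) α₁ α₂
      (α₁ / 2) K fun t => ContinuousLinearMap.adjoint (A (r - t)) := fun r =>
    (isDoeblinFamily_adjoint_nonlocalOperator ha hα₁ hdiss
      (hmeas (fun t => r - t) (by fun_prop))
      (fun x y t => hμ.lower ω x y _) fun x y t => hμ.upper ω x y _).2
  have hpN := hp.isLinearEvolution
  have hNs : 0 ≤ N - s := sub_nonneg.2 hsN
  -- The backward solution restarted at time `s`, so that it can be paired with `u` on `[0, s]`.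
  have hps : IsLinearEvolution (fun t => ContinuousLinearMap.adjoint (A (s - t))) (p s)
      fun t => p (s - t) := by
    have := hpN.shift hNs
    simp only [sub_sub_cancel] at this
    convert! this using 3 <;> ring_nf
  have hmass : inner ℝ (p s) e = 1 := by
    have := (hB N).mass_eq hpN hNs
    rw [sub_sub_cancel] at this
    rw [this, hee]
  -- The terminal value has norm and mass one, so the energy estimate bounds `p s` uniformly in `N`
  -- and `s`.
  have hpnorm : ‖p s‖ ≤ 1 + K / (α₁ / 2) := by
    have h1 := (hB N).norm_sq_le hα₁.le hc hK hS hpN hNs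
    rw [sub_sub_cancel, Lp_norm_const_one, one_pow, mul_one] at h1
    have h2 : Real.exp (-(2 * (α₁ / 2)) * (N - s)) ≤ 1 := by
      rw [Real.exp_le_one_iff]; nlinarith
    have h3 : absMass (Lp.const 2 (volume : Measure (UnitAddTorus (Fin d))) (1 : ℝ)) ^ 2 ≤ 1 := by
      have := absMass_le_norm (Lp.const 2 (volume : Measure (UnitAddTorus (Fin d))) (1 : ℝ))
      rw [Lp_norm_const_one] at this
      exact pow_le_one₀ (absMass_nonneg _) this
    have h4 := mul_le_mul_of_nonneg_left h3 hq
    nlinarith [norm_nonneg (p s)]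
  set c := ∫ ξ : UnitAddTorus (Fin d), u₀ ξ * p 0 ξ with hcdef
  have hcu : inner ℝ (u s) (p s) = c := by
    have := IsLinearEvolution.inner_duality hAb hs.le (hB s).1 hu hps
    rw [this, sub_self, Lp_inner_eq_integral]
  have hconst : Lp.const 2 volume c = c • e := by
    refine Lp.ext ?_
    filter_upwards [Lp.coeFn_const (p := 2) (μ := (volume : Measure (UnitAddTorus (Fin d)))) c,
      Lp.coeFn_smul c e, Lp.coeFn_const (p := 2)
        (μ := (volume : Measure (UnitAddTorus (Fin d)))) (1 : ℝ)] with ξ h1 h2 h3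
    rw [h1, h2, Pi.smul_apply, h3]
    simp
  rw [hconst]
  set w := u s - c • e with hw
  set b := inner ℝ w e with hb
  have hb' : |b| ≤ ‖w‖ := by
    have := abs_real_inner_le_norm w e
    rwa [he, Lp_norm_const_one, mul_one] at this
  -- Subtracting `b • p s`, which has mass `b`, makes the datum mean zero, while its pairing with `u
  -- s` remains `‖w‖ ^ 2`.
  obtain ⟨Q, hQ⟩ := (hB s).1.exists_isLinearEvolution (w - b • p s)
  have h0 : inner ℝ (w - b • p s) e = 0 := by
    rw [inner_sub_left, real_inner_smul_left, hmass, mul_one, sub_self]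
  have hdual := IsLinearEvolution.inner_duality hAb hs.le (hB s).1 hu hQ
  have hww : inner ℝ (u s) (w - b • p s) = ‖w‖ ^ 2 := by
    have h5 : inner ℝ (u s - c • e) w = inner ℝ (u s) w - c * inner ℝ w e := by
      rw [inner_sub_left, real_inner_smul_left, real_inner_comm w e]
    rw [← hw, ← hb] at h5
    rw [inner_sub_right, real_inner_smul_right, hcu, ← real_inner_self_eq_norm_sq, h5]
    ring
  have hQs := hdecay (hB s) hQ h0 s hs.le
  have hq0 : ‖w - b • p s‖ ≤ (2 + K / (α₁ / 2)) * ‖w‖ := by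
    refine (norm_sub_le _ _).trans ?_
    rw [norm_smul, Real.norm_eq_abs]
    have := mul_le_mul hb' hpnorm (norm_nonneg _) (norm_nonneg _)
    linarith
  have hfin : ‖w‖ ^ 2 ≤ ‖u₀‖ * (C * Real.exp (-γ * s) * ((2 + K / (α₁ / 2)) * ‖w‖)) := by
    rw [← hww, hdual]
    refine (real_inner_le_norm _ _).trans (mul_le_mul_of_nonneg_left ?_ (norm_nonneg _))
    exact hQs.trans (mul_le_mul_of_nonneg_left hq0 (by positivity))
  rcases (norm_nonneg w).eq_or_lt with hw0 | hw0
  · rw [← hw0]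
    positivity
  · refine le_of_mul_le_mul_right ?_ hw0
    rw [← pow_two]
    refine hfin.trans (le_of_eq (by ring))
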